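/- Let $B$ be a finite-dimensional C*-algebra and let $X$ be a C*-correspondence over $B$, that is, a right Hilbert $B$-module with inner product $\langle\cdot\,|\,\cdot\rangle$, linear in the second variable, and a $*$-homomorphism $\varphi_X:B\to\mathcal L(X)$ into the adjointable operators. Let $\mathcal K(X)$ be the closed linear span of the rank-one operators $\theta_{\xi,\eta}:\mu\mapsto\xi\cdot\langle\eta\,|\,\mu\rangle$, and let $J_X=\varphi_X^{-1}(\mathcal K(X))\cap(\ker\varphi_X)^\perp$ be the Katsura ideal, where $(\ker\varphi_X)^\perp=\{y\in B: xy=0\text{ for all }x\in\ker\varphi_X\}$. A Toeplitz representation of $X$ in a C*-algebra $D$ is a pair $(\pi,t)$ of a $*$-homomorphism $\pi:B\to D$ and a linear map $t:X\to D$ with $\pi(b)t(\xi)=t(\varphi_X(b)\xi)$ and $t(\xi)^*t(\eta)=\pi(\langle\xi\,|\,\eta\rangle)$. It induces the $*$-homomorphism $\psi_t:\mathcal K(X)\to D$ with $\psi_t(\theta_{\xi,\eta})=t(\xi)t(\eta)^*$. For a closed two-sided $*$-ideal $I\subseteq J_X$ of $B$, the relative Cuntz--Pimsner algebra $\mathcal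 O(I,X)$ is the C*-algebra generated by a Toeplitz representation $(\pi_X^I,t_X^I)$ that is universal among the Toeplitz representations with $\pi(b)=\psi_t(\varphi_X(b))$ for all $b\in I$. The Cuntz--Pimsner algebra is $\mathcal O_X=\mathcal O(J_X,X)$, with universal representation $(\pi_X,t_X)$, and $\tau^I:\mathcal O(I,X)\to\mathcal O_X$ is the canonical $*$-homomorphism, determined by $\tau^I\circ\pi_X^I=\pi_X$ and $\tau^I\circ t_X^I=t_X$. Suppose that $\varphi_X$ is injective and that $\varphi_X(B)\subseteq\mathcal K(X)$ (so that $J_X=B$). If $I$ is a proper closed two-sided $*$-ideal of $B$, then $\tau^I$ is surjective and not injective. -/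

import Mathlib

open scoped ENNReal

noncomputable section

universe u v w

namespace CStarCorr

section HilbertModule

/- A right Hilbert `B`-module is a Banach space `X` with a right action of `B` (an action of the
opposite algebra `Bᵐᵒᵖ`, as usual in Mathlib) and a `Bᵐᵒᵖ`-valued inner product which is
`Bᵐᵒᵖ`-linear in the second variable, that is, an instance of `CStarModule Bᵐᵒᵖ X`, complete for
its norm `‖ξ‖ = √‖⟨ξ|ξ⟩‖`. -/
variable {B : Type u} {X : Type v} [NonUnitalCStarAlgebra B] [PartialOrder B]
  [NormedAddCommGroup X] [NormedSpace ℂ X] [SMul Bᵐᵒᵖ X] [CStarModule Bᵐᵒᵖ X]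

/-- The `B`-valued inner product `⟨ξ|η⟩` of a right Hilbert `B`-module, linear in `η`. -/
def rinner (B : Type u) {X : Type v} [NonUnitalCStarAlgebra B] [PartialOrder B]
    [NormedAddCommGroup X] [NormedSpace ℂ X] [SMul Bᵐᵒᵖ X] [CStarModule Bᵐᵒᵖ X] (ξ η : X) : B :=
  MulOpposite.unop (inner Bᵐᵒᵖ ξ η)

/-- The right action `ξ · b`. -/
def ract (ξ : X) (b : B) : X := MulOpposite.op b • ξ

lemma rinner_ract (ξ η : X) (b : B) : rinner B ξ (ract η b) = rinner B ξ η * b := by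
  simp [rinner, ract]

lemma star_rinner (ξ η : X) : star (rinner B ξ η) = rinner B η ξ := by
  rw [rinner, rinner, ← MulOpposite.unop_star, CStarModule.star_inner]

lemma rinner_add_right (ξ η ζ : X) : rinner B ξ (η + ζ) = rinner B ξ η + rinner B ξ ζ := by
  simp [rinner]

lemma rinner_smul_right (ξ η : X) (z : ℂ) : rinner B ξ (z • η) = z • rinner B ξ η := by
  simp [rinner]

lemma rinner_sub_right (ξ η ζ : X) : rinner B ξ (η - ζ) = rinner B ξ η - rinner B ξ ζ := by
  simp [rinner]

lemma rinner_ext {ξ η : X} (h : ∀ ζ : X, rinner B ζ ξ = rinner B ζ η) : ξ = η := by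
  have h1 : rinner B (ξ - η) (ξ - η) = 0 := by rw [rinner_sub_right, h, sub_self]
  have h2 : inner Bᵐᵒᵖ (ξ - η) (ξ - η) = 0 := MulOpposite.unop_injective h1
  exact sub_eq_zero.1 (CStarModule.inner_self.1 h2)

lemma norm_sq_rinner (ξ : X) : ‖ξ‖ ^ 2 = ‖rinner B ξ ξ‖ :=
  CStarModule.norm_sq_eq Bᵐᵒᵖ

lemma ract_add (ξ : X) (a b : B) : ract ξ (a + b) = ract ξ a + ract ξ b :=
  rinner_ext (B := B) fun ζ => by simp only [rinner_ract, rinner_add_right, mul_add]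

lemma ract_smul (ξ : X) (z : ℂ) (b : B) : ract ξ (z • b) = z • ract ξ b :=
  rinner_ext (B := B) fun ζ => by simp only [rinner_ract, rinner_smul_right, mul_smul_comm]

lemma rinner_ract_left (ξ η : X) (b : B) : rinner B (ract ξ b) η = star b * rinner B ξ η := by
  rw [← star_rinner, rinner_ract, star_mul, star_rinner]

lemma norm_ract_le (ξ : X) (b : B) : ‖ract ξ b‖ ≤ ‖ξ‖ * ‖b‖ := by
  refine le_of_sq_le_sq ?_ (by positivity)
  calc ‖ract ξ b‖ ^ 2 = ‖star b * (rinner B ξ ξ * b)‖ := by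
        rw [norm_sq_rinner (B := B), rinner_ract, rinner_ract_left, mul_assoc]
    _ ≤ ‖b‖ * (‖rinner B ξ ξ‖ * ‖b‖) := by
        refine (norm_mul_le _ _).trans ?_
        rw [norm_star]
        gcongr
        exact norm_mul_le _ _
    _ = (‖ξ‖ * ‖b‖) ^ 2 := by rw [← norm_sq_rinner]; ring

lemma norm_rinner_le [StarOrderedRing B] (ξ η : X) : ‖rinner B ξ η‖ ≤ ‖ξ‖ * ‖η‖ :=
  CStarModule.norm_inner_le (A := Bᵐᵒᵖ) X

variable [StarOrderedRing B]

/-- The rank-one operator `θ_{ξ,η} : μ ↦ ξ · ⟨η|μ⟩`. -/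
def rankOne (B : Type u) {X : Type v} [NonUnitalCStarAlgebra B] [PartialOrder B]
    [StarOrderedRing B] [NormedAddCommGroup X] [NormedSpace ℂ X] [SMul Bᵐᵒᵖ X]
    [CStarModule Bᵐᵒᵖ X] (ξ η : X) : X →L[ℂ] X :=
  LinearMap.mkContinuous
    { toFun := fun μ => ract ξ (rinner B η μ)
      map_add' := fun μ ν => by rw [rinner_add_right, ract_add]
      map_smul' := fun z μ => by rw [rinner_smul_right, ract_smul, RingHom.id_apply] }
    (‖ξ‖ * ‖η‖) (fun μ => by
      refine (norm_ract_le ξ (rinner B η μ)).trans ?_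
      rw [mul_assoc]
      gcongr
      exact norm_rinner_le η μ)

lemma rankOne_apply (ξ η μ : X) : rankOne B ξ η μ = ract ξ (rinner B η μ) := rfl

/-- `𝒦(X)`: the norm-closed linear span of the rank-one operators. (An adjointable operator is
bounded, and the norm of `ℒ(X)` is the operator norm, so the closure may be taken among all the
bounded operators.) -/
def compactOps (B : Type u) (X : Type v) [NonUnitalCStarAlgebra B] [PartialOrder B]
    [StarOrderedRing B] [NormedAddCommGroup X] [NormedSpace ℂ X] [SMul Bᵐᵒᵖ X]
    [CStarModule Bᵐᵒᵖ X] : Submodule ℂ (X →L[ℂ] X) :=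
  (Submodule.span ℂ (Set.range fun p : X × X => rankOne B p.1 p.2)).topologicalClosure

lemma rankOne_mem (ξ η : X) : rankOne B ξ η ∈ compactOps B X :=
  Submodule.le_topologicalClosure _ (Submodule.subset_span ⟨(ξ, η), rfl⟩)

instance : IsBoundedSMul ℂ (compactOps B X) :=
  .of_norm_smul_le fun r T => norm_smul_le r (T : X →L[ℂ] X)

/-- The linear map `∑ cᵢ (ξᵢ, ηᵢ) ↦ ∑ cᵢ θ_{ξᵢ,ηᵢ}` into `𝒦(X)`. -/
def finiteRank (B : Type u) (X : Type v) [NonUnitalCStarAlgebra B] [PartialOrder B]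
    [StarOrderedRing B] [NormedAddCommGroup X] [NormedSpace ℂ X] [SMul Bᵐᵒᵖ X]
    [CStarModule Bᵐᵒᵖ X] : (X × X →₀ ℂ) →ₗ[ℂ] compactOps B X :=
  Finsupp.linearCombination ℂ fun p : X × X => (⟨rankOne B p.1 p.2, rankOne_mem p.1 p.2⟩)

lemma coe_finiteRank (f : X × X →₀ ℂ) : (finiteRank B X f : X →L[ℂ] X) =
    Finsupp.linearCombination ℂ (fun p : X × X => rankOne B p.1 p.2) f := by
  simp [finiteRank, Finsupp.linearCombination_apply, Finsupp.sum]

lemma denseRange_finiteRank : DenseRange (finiteRank B X) := by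
  intro T
  have hT : (T : X →L[ℂ] X) ∈ closure
      (Submodule.span ℂ (Set.range fun p : X × X => rankOne B p.1 p.2) : Set (X →L[ℂ] X)) := T.2
  rw [closure_subtype]
  refine closure_mono ?_ hT
  intro S hS
  rw [SetLike.mem_coe, ← Set.image_univ, Finsupp.mem_span_image_iff_linearCombination] at hS
  obtain ⟨f, -, rfl⟩ := hS
  exact ⟨finiteRank B X f, ⟨f, rfl⟩, coe_finiteRank f⟩

end HilbertModule

/-- A C*-correspondence over `B`: a right Hilbert `B`-module `X` with a `*`-homomorphism
`φ_X : B → ℒ(X)`, that is, a homomorphism into the bounded operators for which `φ_X (b*)` is an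
adjoint of `φ_X b`. -/
structure Correspondence (B : Type u) (X : Type v) [NonUnitalCStarAlgebra B] [PartialOrder B]
    [StarOrderedRing B] [NormedAddCommGroup X] [NormedSpace ℂ X] [CompleteSpace X]
    [SMul Bᵐᵒᵖ X] [CStarModule Bᵐᵒᵖ X] where
  leftAct : B →ₙₐ[ℂ] (X →L[ℂ] X)
  rinner_leftAct : ∀ (b : B) (ξ η : X),
    rinner B (leftAct b ξ) η = rinner B ξ (leftAct (star b) η)

section Correspondence

variable {B : Type u} {X : Type v} [NonUnitalCStarAlgebra B] [PartialOrder B]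
  [StarOrderedRing B] [NormedAddCommGroup X] [NormedSpace ℂ X] [CompleteSpace X]
  [SMul Bᵐᵒᵖ X] [CStarModule Bᵐᵒᵖ X]

/-- The Katsura ideal `J_X = φ_X⁻¹(𝒦(X)) ∩ (ker φ_X)^⊥`. -/
def Correspondence.katsuraIdeal (E : Correspondence B X) : Set B :=
  {y | E.leftAct y ∈ compactOps B X ∧ ∀ x : B, E.leftAct x = 0 → x * y = 0}

/-- A Toeplitz representation `(π, t)` of the correspondence in a C*-algebra `D`. -/
structure ToeplitzRep (E : Correspondence B X) (D : Type w) [NonUnitalCStarAlgebra D] where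
  π : B →⋆ₙₐ[ℂ] D
  t : X →ₗ[ℂ] D
  π_mul_t : ∀ (b : B) (ξ : X), π b * t ξ = t (E.leftAct b ξ)
  star_t_mul_t : ∀ ξ η : X, star (t ξ) * t η = π (rinner B ξ η)

namespace ToeplitzRep

variable {E : Correspondence B X} {D : Type w} [NonUnitalCStarAlgebra D]

lemma t_mul_π (R : ToeplitzRep E D) (ξ : X) (b : B) : R.t ξ * R.π b = R.t (ract ξ b) := by
  have h : ∀ η : X, star (R.t η) * (R.t ξ * R.π b - R.t (ract ξ b)) = 0 := by
    intro η
    rw [mul_sub, ← mul_assoc, R.star_t_mul_t, R.star_t_mul_t, rinner_ract, map_mul, sub_self]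
  rw [← sub_eq_zero, ← CStarRing.star_mul_self_eq_zero_iff]
  rw [star_sub, star_mul, sub_mul, mul_assoc, h, h]
  simp

lemma norm_t_le (R : ToeplitzRep E D) (ξ : X) : ‖R.t ξ‖ ≤ ‖ξ‖ := by
  refine le_of_sq_le_sq ?_ (norm_nonneg _)
  rw [norm_sq_rinner (B := B) ξ, sq, ← CStarRing.norm_star_mul_self, R.star_t_mul_t]
  exact NonUnitalStarAlgHom.norm_apply_le R.π _

/-- The linear map `∑ cᵢ (ξᵢ, ηᵢ) ↦ ∑ cᵢ t(ξᵢ) t(ηᵢ)*`. -/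
def finiteRankMap (R : ToeplitzRep E D) : (X × X →₀ ℂ) →ₗ[ℂ] D :=
  Finsupp.linearCombination ℂ fun p : X × X => R.t p.1 * star (R.t p.2)

/-- The canonical map `ψ_t : 𝒦(X) → D`, the continuous linear map with
`ψ_t(θ_{ξ,η}) = t(ξ) t(η)*`: see `ToeplitzRep.compactMap_rankOne`. -/
def compactMap (R : ToeplitzRep E D) : compactOps B X →L[ℂ] D :=
  R.finiteRankMap.extendOfNorm (finiteRank B X)

/-- `(π, t)` is co-isometric on `S` if `π(b) = ψ_t(φ_X(b))` for all `b ∈ S`. -/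
def IsCoisometricOn (R : ToeplitzRep E D) (S : Set B) : Prop :=
  ∀ b ∈ S, ∃ h : E.leftAct b ∈ compactOps B X, R.π b = R.compactMap ⟨E.leftAct b, h⟩

lemma finiteRankMap_mul_t (R : ToeplitzRep E D) (f : X × X →₀ ℂ) (μ : X) :
    R.finiteRankMap f * R.t μ = R.t ((finiteRank B X f : X →L[ℂ] X) μ) := by
  rw [coe_finiteRank, finiteRankMap]
  induction f using Finsupp.induction_linear with
  | zero => simp
  | add f g hf hg => simp only [map_add, add_mul, hf, hg, _root_.add_apply]
  | single p c =>
    simp only [Finsupp.linearCombination_single, smul_mul_assoc, _root_.smul_apply,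
      map_smul, rankOne_apply, mul_assoc, R.star_t_mul_t, R.t_mul_π]

lemma exists_adjoint (R : ToeplitzRep E D) (f : X × X →₀ ℂ) : ∃ g : X × X →₀ ℂ,
    R.finiteRankMap g = star (R.finiteRankMap f) ∧
    ∀ ξ η : X, rinner B ((finiteRank B X g : X →L[ℂ] X) ξ) η =
      rinner B ξ ((finiteRank B X f : X →L[ℂ] X) η) := by
  simp only [coe_finiteRank, finiteRankMap]
  induction f using Finsupp.induction_linear with
  | zero =>
    refine ⟨0, by simp, fun ξ η => ?_⟩
    simp [rinner]
  | add f g hf hg =>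
    obtain ⟨f', hf1, hf2⟩ := hf
    obtain ⟨g', hg1, hg2⟩ := hg
    refine ⟨f' + g', by simp only [map_add, hf1, hg1, star_add], fun ξ η => ?_⟩
    simp only [map_add, _root_.add_apply, rinner_add_right, ← hf2, ← hg2]
    simp [rinner]
  | single p c =>
    refine ⟨Finsupp.single (p.2, p.1) (star c), by simp, fun ξ η => ?_⟩
    simp only [Finsupp.linearCombination_single, _root_.smul_apply, rankOne_apply,
      rinner_smul_right, rinner_ract]
    rw [← star_rinner, rinner_smul_right, rinner_ract]
    simp [star_rinner]

lemma exists_bound (R : ToeplitzRep E D) (f : X × X →₀ ℂ) : ∃ C : ℝ, 0 ≤ C ∧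
    ∀ (y : Unitization ℂ D) (S : X →L[ℂ] X),
      (∀ μ, y * (R.t μ : Unitization ℂ D) = (R.t (S μ) : Unitization ℂ D)) →
      ‖y * (R.finiteRankMap f : Unitization ℂ D)‖ ≤ C * ‖S‖ := by
  simp only [finiteRankMap]
  induction f using Finsupp.induction_linear with
  | zero => exact ⟨0, le_rfl, fun y S _ => by simp⟩
  | add f g hf hg =>
    obtain ⟨C, hC, hf⟩ := hf
    obtain ⟨C', hC', hg⟩ := hg
    refine ⟨C + C', by positivity, fun y S h => ?_⟩
    rw [map_add, Unitization.inr_add, mul_add, add_mul]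
    exact (norm_add_le _ _).trans (add_le_add (hf y S h) (hg y S h))
  | single p c =>
    refine ⟨‖c‖ * (‖p.1‖ * ‖p.2‖), by positivity, fun y S h => ?_⟩
    rw [Finsupp.linearCombination_single, Unitization.inr_smul, mul_smul_comm, norm_smul,
      Unitization.inr_mul, ← mul_assoc, h, ← Unitization.inr_mul, Unitization.norm_inr, mul_assoc]
    gcongr
    calc ‖R.t (S p.1) * star (R.t p.2)‖ ≤ ‖R.t (S p.1)‖ * ‖star (R.t p.2)‖ := norm_mul_le _ _
      _ ≤ (‖S‖ * ‖p.1‖) * ‖p.2‖ := by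
        rw [norm_star]
        gcongr
        · exact (R.norm_t_le _).trans (S.le_opNorm _)
        · exact R.norm_t_le _
      _ = ‖p.1‖ * ‖p.2‖ * ‖S‖ := by ring

lemma le_of_pow_bound {y s C : ℝ} (hs : 0 ≤ s)
    (h : ∀ n : ℕ, y ^ 2 ^ n ≤ C * s ^ (2 ^ n - 1)) : y ≤ s := by
  rcases hs.eq_or_lt with rfl | hs
  · have := h 1
    norm_num at this
    nlinarith
  · by_contra! hlt
    have h1 : 1 < y / s := (one_lt_div hs).2 hlt
    obtain ⟨n, hn⟩ := pow_unbounded_of_one_lt (C / s) h1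
    have h2 : (y / s) ^ n ≤ (y / s) ^ 2 ^ n :=
      pow_le_pow_right₀ h1.le Nat.lt_two_pow_self.le
    have h3 : (y / s) ^ 2 ^ n ≤ C / s := by
      rw [div_pow, div_le_div_iff₀ (by positivity) hs]
      have h4 : s ^ 2 ^ n = s ^ (2 ^ n - 1) * s := by
        rw [← pow_succ, Nat.sub_add_cancel Nat.one_le_two_pow]
      rw [h4, ← mul_assoc]
      gcongr
      exact h n
    linarith

/-- The map `θ_{ξ,η} ↦ t(ξ) t(η)*` is contractive on finite sums, so that `ψ_t` is well defined. -/
lemma norm_finiteRankMap_le (R : ToeplitzRep E D) (f : X × X →₀ ℂ) :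
    ‖R.finiteRankMap f‖ ≤ 1 * ‖finiteRank B X f‖ := by
  rw [one_mul, Submodule.coe_norm]
  obtain ⟨g, hg1, hg2⟩ := R.exists_adjoint f
  set a := R.finiteRankMap f with ha
  set T : X →L[ℂ] X := (finiteRank B X f : X →L[ℂ] X) with hT
  set T' : X →L[ℂ] X := (finiteRank B X g : X →L[ℂ] X) with hT'
  have hTT : ‖T'‖ ≤ ‖T‖ := by
    refine ContinuousLinearMap.opNorm_le_bound _ (norm_nonneg _) fun ξ => ?_
    have h1 : ‖T' ξ‖ ^ 2 ≤ ‖T' ξ‖ * (‖T‖ * ‖ξ‖) := by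
      rw [norm_sq_rinner (B := B), hg2, mul_comm, mul_comm ‖T‖, mul_assoc]
      refine (norm_rinner_le _ _).trans ?_
      gcongr
      exact T.le_opNorm _
    rcases (norm_nonneg (T' ξ)).eq_or_lt with h0 | h0
    · rw [← h0]; positivity
    · rw [sq] at h1
      exact le_of_mul_le_mul_left h1 h0
  set x : Unitization ℂ D := ((a * star a : D) : Unitization ℂ D) with hx
  have hxt : ∀ (m : ℕ) (μ : X), x ^ m * (R.t μ : Unitization ℂ D) =
      (R.t (((T * T') ^ m) μ) : Unitization ℂ D) := by
    intro m
    induction m with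
    | zero => intro μ; simp
    | succ m ih =>
      intro μ
      have : x * (R.t μ : Unitization ℂ D) = (R.t ((T * T') μ) : Unitization ℂ D) := by
        rw [hx, ← Unitization.inr_mul, mul_assoc, ← hg1, finiteRankMap_mul_t, ha,
          finiteRankMap_mul_t]
        rfl
      rw [pow_succ, mul_assoc, this, ih, pow_succ]
      rfl
  obtain ⟨C, hC, hb⟩ := R.exists_bound f
  have hsa : IsSelfAdjoint x := by
    rw [hx, isSelfAdjoint_iff, ← Unitization.inr_star, star_mul, star_star]
  have hnx : ‖x‖ = ‖a‖ ^ 2 := by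
    rw [hx, Unitization.norm_inr, CStarRing.norm_self_mul_star, sq]
  have key : ‖x‖ ≤ ‖T * T'‖ := by
    refine le_of_pow_bound (C := C * ‖a‖) (norm_nonneg _) fun n => ?_
    have h1 : ‖x ^ 2 ^ n‖ = ‖x‖ ^ 2 ^ n := by
      have := hsa.nnnorm_pow_two_pow n
      simpa only [NNReal.coe_pow, coe_nnnorm] using congrArg NNReal.toReal this
    have hp : 2 ^ n = (2 ^ n - 1) + 1 := (Nat.sub_add_cancel Nat.one_le_two_pow).symm
    rw [← h1]
    calc ‖x ^ 2 ^ n‖ = ‖x ^ (2 ^ n - 1) * (a : Unitization ℂ D) * ((star a : D) : Unitization ℂ D)‖ := by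
          conv_lhs => rw [hp, pow_succ]
          rw [mul_assoc, ← Unitization.inr_mul]
      _ ≤ (C * ‖(T * T') ^ (2 ^ n - 1)‖) * ‖a‖ := by
          refine (norm_mul_le _ _).trans ?_
          rw [Unitization.norm_inr, norm_star]
          gcongr
          exact hb _ _ (hxt _)
      _ ≤ C * ‖a‖ * ‖T * T'‖ ^ (2 ^ n - 1) := by
          rw [mul_right_comm]
          gcongr
          rcases Nat.eq_zero_or_pos (2 ^ n - 1) with h0 | h0
          · rw [h0, pow_zero, pow_zero]
            exact ContinuousLinearMap.norm_id_le
          · exact norm_pow_le' _ h0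
  have : ‖a‖ ^ 2 ≤ ‖T‖ ^ 2 := by
    rw [← hnx]
    refine key.trans ((norm_mul_le _ _).trans ?_)
    rw [sq]
    gcongr
  exact le_of_sq_le_sq this (norm_nonneg _)

lemma compactMap_finiteRank (R : ToeplitzRep E D) (f : X × X →₀ ℂ) :
    R.compactMap (finiteRank B X f) = R.finiteRankMap f := by
  unfold compactMap
  have h1 : ∃ C : ℝ, ∀ f, ‖R.finiteRankMap f‖ ≤ C * ‖finiteRank B X f‖ :=
    ⟨1, R.norm_finiteRankMap_le⟩
  have h2 := denseRange_finiteRank (B := B) (X := X)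
  generalize R.finiteRankMap = g at *
  generalize finiteRank B X = e at *
  exact LinearMap.extendOfNorm_eq h2 h1 f

lemma compactMap_rankOne (R : ToeplitzRep E D) (ξ η : X) :
    R.compactMap ⟨rankOne B ξ η, rankOne_mem ξ η⟩ = R.t ξ * star (R.t η) := by
  have h := R.compactMap_finiteRank (Finsupp.single (ξ, η) 1)
  have h1 : finiteRank B X (Finsupp.single (ξ, η) 1) = ⟨rankOne B ξ η, rankOne_mem ξ η⟩ := by
    rw [finiteRank, Finsupp.linearCombination_single, one_smul]
  rwa [h1, finiteRankMap, Finsupp.linearCombination_single, one_smul] at h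

lemma norm_compactMap_le (R : ToeplitzRep E D) (T : compactOps B X) :
    ‖R.compactMap T‖ ≤ ‖T‖ := by
  unfold compactMap
  have h1 := R.norm_finiteRankMap_le
  have h2 := denseRange_finiteRank (B := B) (X := X)
  generalize R.finiteRankMap = g at *
  generalize finiteRank B X = e at *
  have h3 := LinearMap.norm_extendOfNorm_apply_le h2 1 h1 T
  rwa [one_mul] at h3

lemma compactMap_unique (R : ToeplitzRep E D) (ψ : compactOps B X →L[ℂ] D)
    (h : ∀ ξ η : X, ψ ⟨rankOne B ξ η, rankOne_mem ξ η⟩ = R.t ξ * star (R.t η)) :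
    R.compactMap = ψ := by
  have h3 : ∀ f, ψ (finiteRank B X f) = R.finiteRankMap f := by
    intro f
    rw [finiteRank, finiteRankMap, Finsupp.linearCombination_apply,
      Finsupp.linearCombination_apply, Finsupp.sum, Finsupp.sum, map_sum]
    exact Finset.sum_congr rfl fun p _ => by rw [map_smul, h]
  have h2 := denseRange_finiteRank (B := B) (X := X)
  refine ContinuousLinearMap.ext fun T => ?_
  refine congrFun (h2.equalizer R.compactMap.continuous ψ.continuous ?_) T
  funext f
  exact (R.compactMap_finiteRank f).trans (h3 f).symm

/-- The composition of a Toeplitz representation with a `*`-homomorphism. -/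
def map (R : ToeplitzRep E D) {D' : Type*} [NonUnitalCStarAlgebra D'] (ρ : D →⋆ₙₐ[ℂ] D') :
    ToeplitzRep E D' where
  π := ρ.comp R.π
  t := (ρ : D →ₗ[ℂ] D').comp R.t
  π_mul_t b ξ := by
    simpa using congrArg ρ (R.π_mul_t b ξ)
  star_t_mul_t ξ η := by
    have h := congrArg ρ (R.star_t_mul_t ξ η)
    rw [map_mul, map_star] at h
    exact h

lemma compactMap_map (R : ToeplitzRep E D) {D' : Type*} [NonUnitalCStarAlgebra D']
    (ρ : D →⋆ₙₐ[ℂ] D') (T : compactOps B X) :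
    (R.map ρ).compactMap T = ρ (R.compactMap T) := by
  let ρ' : D →L[ℂ] D' := LinearMap.mkContinuous (ρ : D →ₗ[ℂ] D') 1 fun x => by
    simpa using NonUnitalStarAlgHom.norm_apply_le ρ x
  rw [(R.map ρ).compactMap_unique (ρ'.comp R.compactMap) fun ξ η => ?_]
  · rfl
  · rw [ContinuousLinearMap.comp_apply, compactMap_rankOne]
    change ρ _ = ρ _ * star (ρ _)
    rw [map_mul, map_star]

lemma IsCoisometricOn.map {R : ToeplitzRep E D} {S : Set B} (hR : R.IsCoisometricOn S)
    {D' : Type*} [NonUnitalCStarAlgebra D'] (ρ : D →⋆ₙₐ[ℂ] D') :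
    (R.map ρ).IsCoisometricOn S := by
  intro b hb
  obtain ⟨h, hb⟩ := hR b hb
  exact ⟨h, by rw [compactMap_map, ← hb]; rfl⟩

/-- The product of a family of Toeplitz representations, in the C*-algebra of bounded families. -/
def pi {ι : Type*} {A : ι → Type w} [∀ i, NonUnitalCStarAlgebra (A i)]
    (R : ∀ i, ToeplitzRep E (A i)) : ToeplitzRep E (lp A ∞) where
  π :=
    { toFun := fun b => ⟨fun i => (R i).π b, memℓp_infty ⟨‖b‖, by
        rintro _ ⟨i, rfl⟩
        exact NonUnitalStarAlgHom.norm_apply_le (R i).π b⟩⟩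
      map_smul' := fun z b => by ext i; exact map_smul (R i).π z b
      map_zero' := by ext i; exact map_zero (R i).π
      map_add' := fun a b => by ext i; exact map_add (R i).π a b
      map_mul' := fun a b => by ext i; exact map_mul (R i).π a b
      map_star' := fun b => by ext i; exact map_star (R i).π b }
  t :=
    { toFun := fun ξ => ⟨fun i => (R i).t ξ, memℓp_infty ⟨‖ξ‖, by
        rintro _ ⟨i, rfl⟩
        exact (R i).norm_t_le ξ⟩⟩
      map_smul' := fun z b => by ext i; exact map_smul (R i).t z b
      map_add' := fun a b => by ext i; exact map_add (R i).t a b }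
  π_mul_t b ξ := by ext i; exact (R i).π_mul_t b ξ
  star_t_mul_t ξ η := by ext i; exact (R i).star_t_mul_t ξ η

/-- The coordinate `*`-homomorphisms on the C*-algebra of bounded families. -/
def evalHom {ι : Type*} (A : ι → Type w) [∀ i, NonUnitalCStarAlgebra (A i)] (i : ι) :
    lp A ∞ →⋆ₙₐ[ℂ] A i where
  toFun a := a i
  map_smul' _ _ := rfl
  map_zero' := rfl
  map_add' _ _ := rfl
  map_mul' _ _ := rfl
  map_star' _ := rfl

lemma isCoisometricOn_pi {ι : Type*} {A : ι → Type w} [∀ i, NonUnitalCStarAlgebra (A i)]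
    (R : ∀ i, ToeplitzRep E (A i)) {S : Set B} (hS : ∀ b ∈ S, E.leftAct b ∈ compactOps B X)
    (hR : ∀ i, (R i).IsCoisometricOn S) : (pi R).IsCoisometricOn S := by
  intro b hb
  refine ⟨hS b hb, ?_⟩
  ext i
  obtain ⟨h, hb⟩ := hR i b hb
  exact hb.trans (compactMap_map (pi R) (evalHom A i) _)

/-- The C*-subalgebra `C*(π, t)` generated by a Toeplitz representation. -/
def generated (R : ToeplitzRep E D) : NonUnitalStarSubalgebra ℂ D :=
  (NonUnitalStarAlgebra.adjoin ℂ (Set.range R.π ∪ Set.range R.t)).topologicalClosure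

lemma π_mem (R : ToeplitzRep E D) (b : B) : R.π b ∈ R.generated :=
  NonUnitalStarSubalgebra.le_topologicalClosure _
    (NonUnitalStarAlgebra.subset_adjoin ℂ _ (Or.inl ⟨b, rfl⟩))

lemma t_mem (R : ToeplitzRep E D) (ξ : X) : R.t ξ ∈ R.generated :=
  NonUnitalStarSubalgebra.le_topologicalClosure _
    (NonUnitalStarAlgebra.subset_adjoin ℂ _ (Or.inr ⟨ξ, rfl⟩))

lemma isClosed_generated (R : ToeplitzRep E D) : IsClosed (R.generated : Set D) :=
  NonUnitalStarSubalgebra.isClosed_topologicalClosure _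

instance (R : ToeplitzRep E D) : NonUnitalCStarAlgebra R.generated :=
  NonUnitalStarSubalgebra.nonUnitalCStarAlgebra _ (h_closed := R.isClosed_generated)

/-- A Toeplitz representation, seen in the C*-algebra that it generates. -/
def toGenerated (R : ToeplitzRep E D) : ToeplitzRep E R.generated where
  π := NonUnitalStarAlgHom.codRestrict R.π R.generated R.π_mem
  t := LinearMap.codRestrict R.generated.toNonUnitalSubalgebra.toSubmodule R.t R.t_mem
  π_mul_t b ξ := Subtype.ext (R.π_mul_t b ξ)
  star_t_mul_t ξ η := Subtype.ext (R.star_t_mul_t ξ η)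

lemma IsCoisometricOn.toGenerated {R : ToeplitzRep E D} {S : Set B} (hR : R.IsCoisometricOn S) :
    R.toGenerated.IsCoisometricOn S := by
  intro b hb
  obtain ⟨h, hb⟩ := hR b hb
  refine ⟨h, Subtype.ext ?_⟩
  refine hb.trans ?_
  exact R.toGenerated.compactMap_map (NonUnitalStarSubalgebraClass.subtype R.generated)
    ⟨E.leftAct b, h⟩

lemma generated_le {R : ToeplitzRep E D} {M : NonUnitalStarSubalgebra ℂ D}
    (hM : IsClosed (M : Set D)) (hπ : ∀ b, R.π b ∈ M) (ht : ∀ ξ, R.t ξ ∈ M) :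
    R.generated ≤ M := by
  refine NonUnitalStarSubalgebra.topologicalClosure_minimal _ ?_ hM
  refine NonUnitalStarAlgebra.adjoin_le ?_
  rintro x (⟨b, rfl⟩ | ⟨ξ, rfl⟩)
  · exact hπ b
  · exact ht ξ

lemma generated_toGenerated (R : ToeplitzRep E D) : R.toGenerated.generated = ⊤ := by
  have hc : IsClosed ((R.toGenerated.generated.map
      (NonUnitalStarSubalgebraClass.subtype R.generated) : NonUnitalStarSubalgebra ℂ D) : Set D) :=
    R.isClosed_generated.isClosedEmbedding_subtypeVal.isClosedMap _
      R.toGenerated.isClosed_generated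
  refine eq_top_iff.2 fun x _ => ?_
  obtain ⟨y, hy, hyx⟩ := generated_le hc (fun b => ⟨R.toGenerated.π b, π_mem _ b, rfl⟩)
    (fun ξ => ⟨R.toGenerated.t ξ, t_mem _ ξ, rfl⟩) x.2
  have : y = x := Subtype.ext hyx
  exact this ▸ hy

lemma hom_ext {R : ToeplitzRep E D} (hR : R.generated = ⊤) {D' : Type*}
    [NonUnitalCStarAlgebra D'] {ρ σ : D →⋆ₙₐ[ℂ] D'} (hπ : ∀ b, ρ (R.π b) = σ (R.π b))
    (ht : ∀ ξ, ρ (R.t ξ) = σ (R.t ξ)) : ρ = σ := by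
  have hc : ∀ τ : D →⋆ₙₐ[ℂ] D', Continuous τ := fun τ =>
    AddMonoidHomClass.continuous_of_bound τ 1 fun x => by
      simpa using NonUnitalStarAlgHom.norm_apply_le τ x
  have h := generated_le (R := R) (M := NonUnitalStarAlgHom.equalizer ρ σ)
    (isClosed_eq (hc ρ) (hc σ)) hπ ht
  refine NonUnitalStarAlgHom.ext fun x => ?_
  exact h (hR ▸ NonUnitalStarAlgebra.mem_top : x ∈ R.generated)

end ToeplitzRep

/-- The transport of a C*-algebra structure along a bijection. -/
abbrev transferCStarAlgebra {A : Type w} {A' : Type*} [NonUnitalCStarAlgebra A] (e : A' ≃ A) :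
    NonUnitalCStarAlgebra A' :=
  letI : NonUnitalRing A' := e.nonUnitalRing
  letI : Module ℂ A' := e.module ℂ
  letI f : A' →ₙ+* A := (e.ringEquiv : A' ≃+* A)
  letI : NonUnitalNormedRing A' := NonUnitalNormedRing.induced A' A f e.injective
  have hn : ∀ a : A', ‖a‖ = ‖e a‖ := fun _ => rfl
  have hm : ∀ a b : A', e (a * b) = e a * e b := fun a b => map_mul f a b
  have ha : ∀ a b : A', e (a + b) = e a + e b := fun a b => map_add f a b
  have hs : ∀ (z : ℂ) (a : A'), e (z • a) = z • e a := fun z a => e.apply_symm_apply _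
  { star := fun a => e.symm (star (e a))
    star_involutive := fun a => by simp
    star_mul := fun a b => e.injective (by simp [hm])
    star_add := fun a b => e.injective (by simp [ha])
    norm_mul_self_le := fun a => by
      change ‖e a‖ * ‖e a‖ ≤ ‖e (e.symm (star (e a)) * a)‖
      rw [hm, e.apply_symm_apply, CStarRing.norm_star_mul_self]
    complete := fun {F} hf => by
      have hi : Isometry (e : A' → A) := Isometry.of_dist_eq fun a b => rfl
      exact ((hi.isUniformInducing.completeSpace_congr e.surjective).2 inferInstance).complete hf
    norm_smul_le := fun z a => by
      rw [hn, hs, hn]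
      exact norm_smul_le z (e a)
    smul_assoc := fun z a b => e.injective (by simp only [smul_eq_mul, hm, hs, smul_mul_assoc])
    smul_comm := fun z a b => e.injective (by simp only [smul_eq_mul, hm, hs, mul_smul_comm])
    star_smul := fun z a => e.injective (by
      change e (e.symm (star (e (z • a)))) = e (star z • e.symm (star (e a)))
      simp [hs]) }

lemma exists_transfer {A : Type w} {A' : Type*} [NonUnitalCStarAlgebra A] (e : A' ≃ A) :
    ∃ (_ : NonUnitalCStarAlgebra A') (ρ : A →⋆ₙₐ[ℂ] A'), Function.Injective ρ := by
  let _ := transferCStarAlgebra e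
  exact ⟨inferInstance,
    { toFun := e.symm
      map_smul' := fun z a => by
        change e.symm (z • a) = e.symm (z • e (e.symm a))
        rw [e.apply_symm_apply]
      map_zero' := rfl
      map_add' := fun a b => by
        change e.symm (a + b) = e.symm (e (e.symm a) + e (e.symm b))
        simp
      map_mul' := fun a b => by
        change e.symm (a * b) = e.symm (e (e.symm a) * e (e.symm b))
        simp
      map_star' := fun a => by
        change e.symm (star a) = e.symm (star (e (e.symm a)))
        simp }, e.symm.injective⟩

/-- Formal noncommutative polynomials without constant term in the letters `π(b)`, `t(ξ)` and
`t(ξ)*`. -/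
abbrev Words (B : Type u) (X : Type v) : Type (max u v) :=
  FreeNonUnitalNonAssocAlgebra ℂ (B ⊕ X ⊕ X)

namespace ToeplitzRep

variable {E : Correspondence B X} {D : Type w} [NonUnitalCStarAlgebra D]

/-- The value of a formal polynomial in a Toeplitz representation. -/
def eval (R : ToeplitzRep E D) : Words B X →ₙₐ[ℂ] D :=
  FreeNonUnitalNonAssocAlgebra.lift ℂ (Sum.elim R.π (Sum.elim R.t fun ξ => star (R.t ξ)))

lemma eval_map (R : ToeplitzRep E D) {D' : Type*} [NonUnitalCStarAlgebra D']
    (ρ : D →⋆ₙₐ[ℂ] D') (x : Words B X) : (R.map ρ).eval x = ρ (R.eval x) := by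
  have h : (R.map ρ).eval = (ρ : D →ₙₐ[ℂ] D').comp R.eval := by
    refine FreeNonUnitalNonAssocAlgebra.hom_ext ℂ ?_
    rintro (b | ξ | ξ)
    · simp [eval, ToeplitzRep.map]
      rfl
    · simp [eval, ToeplitzRep.map]
      rfl
    · simp only [eval, ToeplitzRep.map, NonUnitalAlgHom.comp_apply,
        FreeNonUnitalNonAssocAlgebra.lift_of_apply, Sum.elim_inr]
      exact (map_star ρ (R.t ξ)).symm
  rw [h]
  rfl

lemma exists_eval_eq (R : ToeplitzRep E D) {a : D}
    (ha : a ∈ NonUnitalStarAlgebra.adjoin ℂ (Set.range R.π ∪ Set.range R.t)) :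
    ∃ x y : Words B X, R.eval x = a ∧ R.eval y = star a := by
  induction ha using NonUnitalStarAlgebra.adjoin_induction with
  | mem a ha =>
    rcases ha with ⟨b, rfl⟩ | ⟨ξ, rfl⟩
    · exact ⟨.of ℂ (.inl b), .of ℂ (.inl (star b)), by simp [eval], by simp [eval, map_star]⟩
    · exact ⟨.of ℂ (.inr (.inl ξ)), .of ℂ (.inr (.inr ξ)), by simp [eval], by simp [eval]⟩
  | add a b _ _ ha hb =>
    obtain ⟨x, y, hx, hy⟩ := ha
    obtain ⟨x', y', hx', hy'⟩ := hb
    exact ⟨x + x', y + y', by rw [map_add, hx, hx'], by rw [map_add, hy, hy', star_add]⟩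
  | zero => exact ⟨0, 0, map_zero _, by rw [map_zero, star_zero]⟩
  | mul a b _ _ ha hb =>
    obtain ⟨x, y, hx, hy⟩ := ha
    obtain ⟨x', y', hx', hy'⟩ := hb
    exact ⟨x * x', y' * y, by rw [map_mul, hx, hx'], by rw [map_mul, hy, hy', star_mul]⟩
  | smul z a _ ha =>
    obtain ⟨x, y, hx, hy⟩ := ha
    exact ⟨z • x, star z • y, by rw [map_smul, hx], by rw [map_smul, hy, star_smul]⟩
  | star a _ ha =>
    obtain ⟨x, y, hx, hy⟩ := ha
    exact ⟨y, x, hy, by rw [hx, star_star]⟩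

/-- The direct sum of two Toeplitz representations. -/
def prod (R : ToeplitzRep E D) {D' : Type*} [NonUnitalCStarAlgebra D'] (R' : ToeplitzRep E D') :
    ToeplitzRep E (D × D') where
  π := R.π.prod R'.π
  t := R.t.prod R'.t
  π_mul_t b ξ := Prod.ext (R.π_mul_t b ξ) (R'.π_mul_t b ξ)
  star_t_mul_t ξ η := Prod.ext (R.star_t_mul_t ξ η) (R'.star_t_mul_t ξ η)

lemma exists_hom_of_norm_le (R : ToeplitzRep E D) {D' : Type*} [NonUnitalCStarAlgebra D']
    (R' : ToeplitzRep E D') (hle : ∀ x, ‖R'.eval x‖ ≤ ‖R.eval x‖) :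
    ∃ ρ : R.generated →⋆ₙₐ[ℂ] D', (∀ b, ρ (R.toGenerated.π b) = R'.π b) ∧
      ∀ ξ, ρ (R.toGenerated.t ξ) = R'.t ξ := by
  set G := R.prod R' with hG
  have hnorm : ∀ γ ∈ G.generated, ‖γ.2‖ ≤ ‖γ.1‖ := by
    intro γ hγ
    have hcl : IsClosed {γ : D × D' | ‖γ.2‖ ≤ ‖γ.1‖} :=
      isClosed_le continuous_snd.norm continuous_fst.norm
    refine closure_minimal ?_ hcl hγ
    intro a ha
    obtain ⟨x, -, hx, -⟩ := G.exists_eval_eq ha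
    have h1 : R.eval x = a.1 := by
      rw [← hx]; exact G.eval_map (NonUnitalStarAlgHom.fst ℂ D D') x
    have h2 : R'.eval x = a.2 := by
      rw [← hx]; exact G.eval_map (NonUnitalStarAlgHom.snd ℂ D D') x
    rw [Set.mem_ofPred_eq, ← h1, ← h2]
    exact hle x
  have huniq : ∀ γ ∈ G.generated, ∀ γ' ∈ G.generated, γ.1 = γ'.1 → γ.2 = γ'.2 := by
    intro γ hγ γ' hγ' h
    have := hnorm _ (sub_mem hγ hγ')
    rw [Prod.fst_sub, h, sub_self, norm_zero] at this
    exact sub_eq_zero.1 (norm_le_zero_iff.1 this)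
  have hex : ∀ d : R.generated, ∃ γ ∈ G.generated, γ.1 = (d : D) := by
    intro d
    have hiso : Isometry fun γ : G.generated => (γ : D × D').1 := by
      refine Isometry.of_dist_eq fun γ γ' => ?_
      rw [Subtype.dist_eq, dist_eq_norm, dist_eq_norm, Prod.norm_def,
        max_eq_left (hnorm _ (sub_mem γ.2 γ'.2))]
      rfl
    have hr : Set.range (fun γ : G.generated => (γ : D × D').1) =
        (G.generated.map (NonUnitalStarAlgHom.fst ℂ D D') : NonUnitalStarSubalgebra ℂ D) := by
      ext x
      exact ⟨fun ⟨γ, h⟩ => ⟨γ, γ.2, h⟩, fun ⟨γ, h, h'⟩ => ⟨⟨γ, h⟩, h'⟩⟩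
    have hc := hiso.isClosedEmbedding.isClosed_range
    rw [hr] at hc
    obtain ⟨γ, h, h'⟩ := generated_le (R := R) hc (fun b => ⟨G.π b, G.π_mem b, rfl⟩)
      (fun ξ => ⟨G.t ξ, G.t_mem ξ, rfl⟩) d.2
    exact ⟨γ, h, h'⟩
  choose g hg hg1 using hex
  refine ⟨{ toFun := fun d => (g d).2
            map_smul' := fun z d => huniq _ (hg _) _ (SMulMemClass.smul_mem z (hg d)) ?_
            map_zero' := huniq _ (hg _) _ (zero_mem _) ?_
            map_add' := fun a b => huniq _ (hg _) _ (add_mem (hg a) (hg b)) ?_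
            map_mul' := fun a b => huniq _ (hg _) _ (mul_mem (hg a) (hg b)) ?_
            map_star' := fun a => huniq _ (hg _) _ (star_mem (hg a)) ?_ },
    fun b => huniq _ (hg _) _ (G.π_mem b) ?_, fun ξ => huniq _ (hg _) _ (G.t_mem ξ) ?_⟩
  · rw [hg1, Prod.smul_fst, hg1]; rfl
  · rw [hg1]; rfl
  · rw [hg1, Prod.fst_add, hg1, hg1]; rfl
  · rw [hg1, Prod.fst_mul, hg1, hg1]; rfl
  · rw [hg1, Prod.fst_star, hg1]; rfl
  · rw [hg1]; rfl
  · rw [hg1]; rfl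

end ToeplitzRep

/-- The seminorms on formal polynomials coming from the Toeplitz representations that are
co-isometric on `S`. They form a set, which indexes a set of representatives of all these
representations. -/
def repNorms (E : Correspondence B X) (S : Set B) : Set (Words B X → ℝ) :=
  {p | ∃ (D : Type (max u v)) (_ : NonUnitalCStarAlgebra D) (R : ToeplitzRep E D),
    R.IsCoisometricOn S ∧ p = fun x => ‖R.eval x‖}

lemma norm_eval_mem_repNorms {E : Correspondence B X} {S : Set B} {D : Type w}
    [NonUnitalCStarAlgebra D] (R : ToeplitzRep E D) (hR : R.IsCoisometricOn S) :
    (fun x => ‖R.eval x‖) ∈ repNorms E S := by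
  have hsmall : Small.{max u v} R.generated := by
    have hsub : (R.generated : Set D) ⊆
        Set.range fun s : ℕ → Words B X => Filter.limUnder Filter.atTop fun n => R.eval (s n) := by
      intro a ha
      obtain ⟨s, hs, hlim⟩ := mem_closure_iff_seq_limit.1
        (show a ∈ closure (NonUnitalStarAlgebra.adjoin ℂ
          (Set.range R.π ∪ Set.range R.t) : Set D) from ha)
      choose x _ hx _ using fun n => R.exists_eval_eq (hs n)
      refine ⟨x, ?_⟩
      simp only [hx]
      exact hlim.limUnder_eq
    exact small_subset hsub
  obtain ⟨inst, ρ, hρ⟩ := exists_transfer (equivShrink.{max u v} R.generated).symm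
  refine ⟨_, inst, R.toGenerated.map ρ, hR.toGenerated.map ρ, ?_⟩
  funext x
  rw [ToeplitzRep.eval_map, NonUnitalStarAlgHom.norm_map ρ hρ]
  have h : R.eval x = (R.toGenerated.eval x : D) :=
    R.toGenerated.eval_map (NonUnitalStarSubalgebraClass.subtype R.generated) x
  rw [h]
  rfl

section Universal

variable (E : Correspondence B X) (S : Set B)

/-- The C*-algebra of a chosen representation with a given seminorm. -/
def RepAlg (p : repNorms E S) : Type (max u v) := p.2.choose

instance (p : repNorms E S) : NonUnitalCStarAlgebra (RepAlg E S p) := p.2.choose_spec.choose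

/-- A chosen representation, co-isometric on `S`, with a given seminorm. -/
def chosenRep (p : repNorms E S) : ToeplitzRep E (RepAlg E S p) :=
  p.2.choose_spec.choose_spec.choose

lemma chosenRep_spec (p : repNorms E S) : (chosenRep E S p).IsCoisometricOn S ∧
    (p : Words B X → ℝ) = fun x => ‖(chosenRep E S p).eval x‖ :=
  p.2.choose_spec.choose_spec.choose_spec

/-- The direct sum of a set of representatives of all the Toeplitz representations that are
co-isometric on `S`. -/
def sumRep : ToeplitzRep E (lp (RepAlg E S) ∞) := ToeplitzRep.pi (chosenRep E S)

/-- The relative Cuntz--Pimsner algebra `𝒪(S, X)`, generated by the universal Toeplitz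
representation of `X` that is co-isometric on `S`. The universal property is
`RelCuntzPimsner.existsUnique_lift`. -/
def RelCuntzPimsner : Type (max u v) := (sumRep E S).generated

instance : NonUnitalCStarAlgebra (RelCuntzPimsner E S) :=
  inferInstanceAs (NonUnitalCStarAlgebra (sumRep E S).generated)

/-- The Cuntz--Pimsner algebra `𝒪_X = 𝒪(J_X, X)`. -/
abbrev CuntzPimsner : Type (max u v) := RelCuntzPimsner E E.katsuraIdeal

namespace RelCuntzPimsner

/-- The universal representation `(π_X^S, t_X^S)` in `𝒪(S, X)`. -/
def univRep : ToeplitzRep E (RelCuntzPimsner E S) := (sumRep E S).toGenerated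

lemma generated_univRep : (univRep E S).generated = ⊤ :=
  (sumRep E S).generated_toGenerated

variable {E S}

lemma isCoisometricOn_univRep (hS : ∀ b ∈ S, E.leftAct b ∈ compactOps B X) :
    (univRep E S).IsCoisometricOn S :=
  (ToeplitzRep.isCoisometricOn_pi (chosenRep E S) hS
    fun p => (chosenRep_spec E S p).1).toGenerated

/-- The universal property of `𝒪(S, X)`, for C*-algebras `D` in every universe. -/
theorem existsUnique_lift {D : Type w} [NonUnitalCStarAlgebra D] (R : ToeplitzRep E D)
    (hR : R.IsCoisometricOn S) : ∃! ρ : RelCuntzPimsner E S →⋆ₙₐ[ℂ] D,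
      (∀ b, ρ ((univRep E S).π b) = R.π b) ∧ ∀ ξ, ρ ((univRep E S).t ξ) = R.t ξ := by
  refine existsUnique_of_exists_of_unique ?_ fun ρ σ hρ hσ =>
    ToeplitzRep.hom_ext (generated_univRep E S) (fun b => (hρ.1 b).trans (hσ.1 b).symm)
      (fun ξ => (hρ.2 ξ).trans (hσ.2 ξ).symm)
  refine (sumRep E S).exists_hom_of_norm_le R fun x => ?_
  let p : repNorms E S := ⟨fun x => ‖R.eval x‖, norm_eval_mem_repNorms R hR⟩
  have h1 : ‖R.eval x‖ = ‖(chosenRep E S p).eval x‖ := congrFun (chosenRep_spec E S p).2 x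
  have h2 : (chosenRep E S p).eval x = ToeplitzRep.evalHom (RepAlg E S) p ((sumRep E S).eval x) :=
    (sumRep E S).eval_map (ToeplitzRep.evalHom (RepAlg E S) p) x
  rw [h1, h2]
  exact NonUnitalStarAlgHom.norm_apply_le (ToeplitzRep.evalHom (RepAlg E S) p) _

/-- The `*`-homomorphism out of `𝒪(S, X)` given by the universal property. -/
def lift {D : Type w} [NonUnitalCStarAlgebra D] (R : ToeplitzRep E D)
    (hR : R.IsCoisometricOn S) : RelCuntzPimsner E S →⋆ₙₐ[ℂ] D :=
  (existsUnique_lift R hR).choose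

lemma lift_π {D : Type w} [NonUnitalCStarAlgebra D] (R : ToeplitzRep E D)
    (hR : R.IsCoisometricOn S) (b : B) : lift R hR ((univRep E S).π b) = R.π b :=
  (existsUnique_lift R hR).choose_spec.1.1 b

lemma lift_t {D : Type w} [NonUnitalCStarAlgebra D] (R : ToeplitzRep E D)
    (hR : R.IsCoisometricOn S) (ξ : X) : lift R hR ((univRep E S).t ξ) = R.t ξ :=
  (existsUnique_lift R hR).choose_spec.1.2 ξ

/-- The canonical map `τ^S : 𝒪(S, X) → 𝒪_X` for `S ⊆ J_X`: the `*`-homomorphism with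
`τ^S ∘ π_X^S = π_X` and `τ^S ∘ t_X^S = t_X`. -/
def toCuntzPimsner (hS : S ⊆ E.katsuraIdeal) : RelCuntzPimsner E S →⋆ₙₐ[ℂ] CuntzPimsner E :=
  lift (univRep E E.katsuraIdeal) fun b hb =>
    isCoisometricOn_univRep (fun _ h => h.1) b (hS hb)

end RelCuntzPimsner
end Universal
end Correspondence
end CStarCorr
end

/-!
A `*`-homomorphism between C*-algebras has closed range, so `τ^I` is onto as soon as its range
contains the generators. If `τ^I` were injective, then every Toeplitz representation that is
co-isometric on `I` would be co-isometric on all of `J_X`, by composing its factorization through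
`𝒪(I, X)` with `τ^I`.

To contradict this, separate some `x ∈ J_X` from the closed ideal `I` by a representation `ρ` of
`B` on a Hilbert space `H` which vanishes on `I` but not at `x`, and let `X` act by creation
operators on the Fock space `⨁ₙ X^{⊗ n} ⊗_ρ H`. The operators `π b` and `ψ_t (φ_X b)` always
agree on `X^{⊗ n} ⊗_ρ H` for `n ≥ 1`, whereas on the vacuum summand `H` the first one is `ρ b` and
the second one vanishes. Hence the Fock representation is co-isometric on `I`, but not at `x`.
-/

noncomputable section

namespace CStarCorr

section ClosedRange

open scoped ComplexStarModule

variable {A : Type*} {D : Type*} [NonUnitalCStarAlgebra A] [NonUnitalCStarAlgebra D]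

lemma exists_map_eq_norm_le_of_isSelfAdjoint (ρ : A →⋆ₙₐ[ℂ] D) {a : A} (ha : IsSelfAdjoint a) :
    ∃ b, ρ b = ρ a ∧ ‖b‖ ≤ ‖ρ a‖ := by
  set r := ‖ρ a‖
  have hr : 0 ≤ r := norm_nonneg _
  -- Truncating the spectrum of `a` at `±‖ρ a‖` does not change `ρ a`.
  let truncate : ℝ → ℝ := fun x ↦ max (-r) (min r x)
  have hcont : Continuous truncate := by fun_prop
  have hzero : truncate 0 = 0 := by simp [truncate, hr]
  have hρ : Continuous ρ := AddMonoidHomClass.continuous_of_bound ρ 1 fun x ↦ by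
    simpa using NonUnitalStarAlgHom.norm_apply_le ρ x
  refine ⟨cfcₙ truncate a, ?_, norm_cfcₙ_le fun x _ ↦ ?_⟩
  · rw [ρ.map_cfcₙ _ a hcont.continuousOn hzero hρ ha (ha.map ρ)]
    conv_rhs => rw [← cfcₙ_id' ℝ (ρ a) (ha.map ρ)]
    refine cfcₙ_congr fun x hx ↦ ?_
    have hxr : |x| ≤ r := by
      simpa only [cfcₙ_id' ℝ (ρ a) (ha.map ρ), Real.norm_eq_abs] using
        norm_apply_le_norm_cfcₙ (fun x : ℝ ↦ x) (ρ a) hx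
    simp only [truncate, min_eq_right (abs_le.1 hxr).2, max_eq_right (abs_le.1 hxr).1]
  · exact abs_le.2 ⟨le_max_left _ _, max_le (neg_le_self hr) (min_le_left _ _)⟩

lemma exists_map_eq_norm_le (ρ : A →⋆ₙₐ[ℂ] D) (a : A) : ∃ b, ρ b = ρ a ∧ ‖b‖ ≤ 2 * ‖ρ a‖ := by
  obtain ⟨b, hb, hb_norm⟩ := exists_map_eq_norm_le_of_isSelfAdjoint ρ (ℜ a).2
  obtain ⟨c, hc, hc_norm⟩ := exists_map_eq_norm_le_of_isSelfAdjoint ρ (ℑ a).2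
  rw [map_realPart] at hb hb_norm
  rw [map_imaginaryPart] at hc hc_norm
  refine ⟨b + Complex.I • c, ?_, ?_⟩
  · rw [map_add, map_smul, hb, hc, realPart_add_I_smul_imaginaryPart]
  · calc ‖b + Complex.I • c‖ ≤ ‖b‖ + ‖c‖ := by
          simpa [norm_smul] using norm_add_le b (Complex.I • c)
      _ ≤ ‖ρ a‖ + ‖ρ a‖ := add_le_add (hb_norm.trans (realPart.norm_le (ρ a)))
          (hc_norm.trans (imaginaryPart.norm_le (ρ a)))
      _ = 2 * ‖ρ a‖ := (two_mul _).symm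

lemma isClosed_range_of_nonUnitalStarAlgHom (ρ : A →⋆ₙₐ[ℂ] D) : IsClosed (Set.range ρ) := by
  let f : NormedAddGroupHom A D := (ρ : A →+ D).mkNormedAddGroupHom 1 fun x ↦ by
    simpa using NonUnitalStarAlgHom.norm_apply_le ρ x
  have hf : f.SurjectiveOnWith f.range.topologicalClosure (2 + 1) :=
    controlled_closure_of_complete two_pos one_pos <| by
      rintro _ ⟨a, rfl⟩
      exact exists_map_eq_norm_le ρ a
  refine isClosed_of_closure_subset fun x hx ↦ ?_
  obtain ⟨a, ha, -⟩ := hf x hx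
  exact ⟨a, ha⟩

end ClosedRange

section Separation

open scoped ComplexOrder ComplexStarModule

variable {B : Type u} [CStarAlgebra B] [PartialOrder B] [StarOrderedRing B]

lemma mem_of_forall_star_mul_self_le {J : Ideal B} (hJ : IsClosed (J : Set B)) {x : B}
    (h : ∀ ε > (0 : ℝ), ∃ j ∈ J, 0 ≤ j ∧ star x * x ≤ ε • (1 + j)) : x ∈ J := by
  refine hJ.closure_subset (Metric.mem_closure_iff.2 fun ε hε ↦ ?_)
  obtain ⟨j, hjJ, hj, hxj⟩ := h (ε ^ 2 / 2) (by positivity)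
  have hone : (1 : B) ≤ 1 + j := le_add_of_nonneg_right hj
  obtain ⟨a, ha⟩ := CStarAlgebra.isUnit_of_le (1 : B) hone
  rw [← ha] at hxj hone
  set u : B := ↑a⁻¹
  have hu : 0 ≤ u := CFC.inv_nonneg_of_nonneg a (zero_le_one.trans hone)
  have hu_norm : ‖u‖ ≤ 1 :=
    (CStarAlgebra.norm_le_one_iff_of_nonneg u hu).2 (CStarAlgebra.inv_le_one hone)
  have hxu : x - x * u * j = x * u := by
    have : u * (1 + j) = 1 := by rw [← ha, Units.inv_mul]
    rw [sub_eq_iff_eq_add, mul_assoc x u j, ← mul_add, ← mul_one_add, this, mul_one]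
  have hle : star (x * u) * (x * u) ≤ (ε ^ 2 / 2) • u := by
    calc star (x * u) * (x * u) = star u * (star x * x) * u := by simp only [star_mul, mul_assoc]
      _ ≤ star u * ((ε ^ 2 / 2) • (a : B)) * u := star_left_conjugate_le_conjugate hxj u
      _ = (ε ^ 2 / 2) • u := by
        rw [hu.isSelfAdjoint.star_eq, mul_smul_comm, Units.inv_mul, smul_mul_assoc, one_mul]
  refine ⟨x * u * j, J.mul_mem_left _ hjJ, ?_⟩
  rw [dist_eq_norm, hxu]
  refine lt_of_pow_lt_pow_left₀ 2 hε.le ?_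
  calc ‖x * u‖ ^ 2 = ‖star (x * u) * (x * u)‖ := by rw [CStarRing.norm_star_mul_self, sq]
    _ ≤ ‖(ε ^ 2 / 2) • u‖ := CStarAlgebra.norm_le_norm_of_nonneg_of_le (star_mul_self_nonneg _) hle
    _ ≤ ε ^ 2 / 2 := by
      rw [norm_smul, Real.norm_of_nonneg (by positivity)]
      exact mul_le_of_le_one_right (by positivity) hu_norm
    _ < ε ^ 2 := half_lt_self (by positivity)

/-- The convex cone generated by the positive elements of `B` and the negative elements of `J`. A
real functional which is nonnegative on it is positive and kills the positive elements of `J`. -/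
def positiveModuloCone (J : Ideal B) : PointedCone ℝ B where
  carrier := {c | ∃ j ∈ J, 0 ≤ j ∧ -j ≤ c}
  zero_mem' := ⟨0, J.zero_mem, le_rfl, by simp⟩
  add_mem' := by
    rintro c d ⟨j, hjJ, hj, hjc⟩ ⟨k, hkJ, hk, hkd⟩
    exact ⟨j + k, J.add_mem hjJ hkJ, add_nonneg hj hk, by rw [neg_add]; exact add_le_add hjc hkd⟩
  smul_mem' := by
    rintro r c ⟨j, hjJ, hj, hjc⟩
    refine ⟨(r : ℝ) • j, ?_, smul_nonneg r.2 hj, ?_⟩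
    · exact Submodule.smul_of_tower_mem J (r : ℝ) hjJ
    · rw [← smul_neg]
      exact smul_le_smul_of_nonneg_left hjc r.2

lemma neg_star_mul_self_notMem_closure {J : Ideal B} (hJ : IsClosed (J : Set B)) {x : B}
    (hx : x ∉ J) : -(star x * x) ∉ (positiveModuloCone J).closure := by
  refine fun hcl ↦ hx (mem_of_forall_star_mul_self_le hJ fun ε hε ↦ ?_)
  obtain ⟨c, ⟨j, hjJ, hj, hjc⟩, hdist⟩ := Metric.mem_closure_iff.1 hcl ε hε
  have hc : IsSelfAdjoint c := by
    simpa using (sub_nonneg.2 hjc).isSelfAdjoint.sub hj.isSelfAdjoint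
  have herror : star x * x + c ≤ algebraMap ℝ B ε := by
    refine ((IsSelfAdjoint.star_mul_self x).add hc).le_algebraMap_norm_self.trans ?_
    rw [dist_comm, dist_eq_norm, sub_neg_eq_add, add_comm] at hdist
    exact algebraMap_mono B hdist.le
  refine ⟨ε⁻¹ • j, J.smul_of_tower_mem _ hjJ, smul_nonneg (by positivity) hj, ?_⟩
  calc star x * x = star x * x + c + -c := by abel
    _ ≤ algebraMap ℝ B ε + j := add_le_add herror (neg_le.1 hjc)
    _ = ε • (1 + ε⁻¹ • j) := by
      rw [smul_add, smul_inv_smul₀ hε.ne', Algebra.algebraMap_eq_smul_one]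

lemma exists_positiveLinearMap_eq (f : B →ₗ[ℝ] ℝ) (hf : ∀ b, 0 ≤ b → 0 ≤ f b) :
    ∃ g : B →ₚ[ℂ] ℂ, ∀ b, 0 ≤ b → g b = f b := by
  let fRe : Module.Dual ℝ B :=
    { toFun b := f (ℜ b)
      map_add' := by simp
      map_smul' := by simp }
  have hg (b : B) (hb : 0 ≤ b) : fRe.extendRCLike (𝕜 := ℂ) b = f b := by
    simp [fRe, Module.Dual.extendRCLike_apply, hb.isSelfAdjoint.coe_realPart, realPart_I_smul,
      hb.isSelfAdjoint.imaginaryPart]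
  exact ⟨.mk₀ fRe.extendRCLike fun b hb ↦ by rw [hg b hb]; exact_mod_cast hf b hb, hg⟩

lemma exists_positiveLinearMap_ne_zero {J : Ideal B} (hJ : IsClosed (J : Set B)) {x : B}
    (hx : x ∉ J) : ∃ f : B →ₚ[ℂ] ℂ, (∀ b ∈ J, f (star b * b) = 0) ∧ f (star x * x) ≠ 0 := by
  let C : ProperCone ℝ B := ⟨(positiveModuloCone J).closure, isClosed_closure⟩
  obtain ⟨g, hg, hgx⟩ := C.hyperplane_separation_point (neg_star_mul_self_notMem_closure hJ hx)
  have hg_nonneg (b : B) (hb : 0 ≤ b) : 0 ≤ g b :=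
    hg b (subset_closure ⟨0, J.zero_mem, le_rfl, by simpa using hb⟩)
  obtain ⟨f, hf⟩ := exists_positiveLinearMap_eq (g : B →ₗ[ℝ] ℝ) hg_nonneg
  refine ⟨f, fun b hb ↦ ?_, ?_⟩
  · have hle : 0 ≤ g (-(star b * b)) := hg _ (subset_closure
      ⟨star b * b, J.mul_mem_left _ hb, star_mul_self_nonneg b, le_rfl⟩)
    rw [map_neg, neg_nonneg] at hle
    have := le_antisymm hle (hg_nonneg _ (star_mul_self_nonneg b))
    simpa [hf _ (star_mul_self_nonneg b)] using this
  · rw [map_neg, neg_lt_zero] at hgx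
    simpa [hf _ (star_mul_self_nonneg x)] using hgx.ne'

lemma norm_sq_gnsNonUnitalStarAlgHom_apply (f : B →ₚ[ℂ] ℂ) (a b : B) :
    (‖f.gnsNonUnitalStarAlgHom a (f.toPreGNS b : f.GNS)‖ ^ 2 : ℂ) =
      f (star (a * b) * (a * b)) := by
  rw [f.gnsNonUnitalStarAlgHom_apply_coe, UniformSpace.Completion.norm_coe, f.preGNS_norm_sq,
    f.leftMulMapPreGNS_apply]
  simp

lemma exists_representation_apply_ne_zero {I : TwoSidedIdeal B} (hI : IsClosed (I : Set B)) {x : B}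
    (hx : x ∉ I) : ∃ (H : Type u) (_ : NormedAddCommGroup H) (_ : InnerProductSpace ℂ H)
      (_ : CompleteSpace H) (ρ : B →⋆ₙₐ[ℂ] (H →L[ℂ] H)), (∀ b ∈ I, ρ b = 0) ∧ ρ x ≠ 0 := by
  obtain ⟨f, hfI, hfx⟩ := exists_positiveLinearMap_ne_zero (J := TwoSidedIdeal.asIdeal I)
    (by simpa using hI) (by simpa using hx)
  refine ⟨f.GNS, inferInstance, inferInstance, inferInstance, f.gnsNonUnitalStarAlgHom,
    fun b hb ↦ ?_, fun hzero ↦ hfx ?_⟩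
  · have hdense : DenseRange ((↑) : f.PreGNS → f.GNS) := UniformSpace.Completion.denseRange_coe
    refine DFunLike.coe_injective (hdense.equalizer (by fun_prop) (by fun_prop) (funext fun c ↦ ?_))
    have h := norm_sq_gnsNonUnitalStarAlgHom_apply f b (f.ofPreGNS c)
    rw [hfI _ (TwoSidedIdeal.mem_asIdeal.2 (I.mul_mem_right _ _ hb)), f.toPreGNS_ofPreGNS] at h
    exact norm_eq_zero.1 (by exact_mod_cast pow_eq_zero_iff two_ne_zero |>.1 h)
  · have h := norm_sq_gnsNonUnitalStarAlgHom_apply f x 1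
    rw [hzero, _root_.zero_apply, norm_zero, mul_one] at h
    simpa using h.symm

end Separation

section TotalFamily

open Set Submodule
open Finsupp (linearCombination linearCombination_apply range_linearCombination single)
open scoped InnerProductSpace ComplexOrder

lemma exists_hilbertSpace_of_posSemidef {α : Type u} {k : Matrix α α ℂ} (hk : k.PosSemidef) :
    ∃ (H : Type u) (_ : NormedAddCommGroup H) (_ : InnerProductSpace ℂ H) (_ : CompleteSpace H)
      (e : α → H), Dense (span ℂ (range e) : Set H) ∧ ∀ a b, ⟪e a, e b⟫_ℂ = k a b := by
  let K : Matrix α α (ℂ →L[ℂ] ℂ) := .of fun a b ↦ k a b • 1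
  have hK (a b : α) (z w : ℂ) : ⟪K a b z, w⟫_ℂ = star z * k b a * w := by
    rw [← hk.1.apply b a]
    simp [K, mul_comm]
  have hpos : K.PosSemidef := by
    refine (RKHS.posSemidef_tfae.out 0 2 rfl rfl).2 ⟨?_, fun v ↦ ?_⟩
    · ext a b
      simp [K, Matrix.conjTranspose_apply, ← hk.1.apply a b]
    · simp only [hK]
      exact (Complex.nonneg_iff.1 (hk.2 v)).1
  have : Fact K.PosSemidef := ⟨hpos⟩
  refine ⟨RKHS.OfKernel K, inferInstance, inferInstance, inferInstance,
    fun a ↦ RKHS.kerFun (RKHS.OfKernel K) a 1, ?_, fun a b ↦ ?_⟩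
  · rw [dense_iff_topologicalClosure_eq_top, eq_top_iff, ← RKHS.kerFun_dense (RKHS.OfKernel K)]
    refine topologicalClosure_mono (span_le.2 ?_)
    rintro _ ⟨a, z, rfl⟩
    rw [← mul_one z, ← smul_eq_mul, map_smul]
    exact smul_mem _ z (subset_span (mem_range_self a))
  · rw [← RKHS.kernel_inner, RKHS.OfKernel.kernel_ofKernel, hK, star_one, one_mul, mul_one]

variable {α H H' : Type*} [NormedAddCommGroup H] [InnerProductSpace ℂ H]
  [NormedAddCommGroup H'] [InnerProductSpace ℂ H'] {e : α → H}

lemma eq_of_forall_inner_eq (he : Dense (span ℂ (range e) : Set H)) {x y : H}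
    (h : ∀ a, ⟪e a, x⟫_ℂ = ⟪e a, y⟫_ℂ) : x = y := by
  refine he.eq_of_inner_right ℂ fun v hv ↦ ?_
  induction hv using span_induction with
  | mem _ hv => obtain ⟨a, rfl⟩ := hv; exact h a
  | zero => simp only [inner_zero_left]
  | add _ _ _ _ hv hw => simp only [inner_add_left, hv, hw]
  | smul c _ _ hv => simp only [inner_smul_left, hv]

lemma clm_ext_of_dense (he : Dense (span ℂ (range e) : Set H)) {S T : H →L[ℂ] H'}
    (h : ∀ a, S (e a) = T (e a)) : S = T :=
  ContinuousLinearMap.ext_on he (forall_mem_range.2 h)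

lemma inner_linearCombination_eq {f g : α → H} {f' g' : α → H'}
    (h : ∀ a b, ⟪f a, g b⟫_ℂ = ⟪f' a, g' b⟫_ℂ) (v w : α →₀ ℂ) :
    ⟪linearCombination ℂ f v, linearCombination ℂ g w⟫_ℂ =
      ⟪linearCombination ℂ f' v, linearCombination ℂ g' w⟫_ℂ := by
  simp only [linearCombination_apply, Finsupp.sum_inner, Finsupp.inner_sum, inner_smul_left,
    inner_smul_right, h]

lemma exists_clm_of_norm_linearCombination_le [CompleteSpace H']
    (he : Dense (span ℂ (range e) : Set H)) {f : α → H'} {C : ℝ}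
    (hf : ∀ v, ‖linearCombination ℂ f v‖ ≤ C * ‖linearCombination ℂ e v‖) :
    ∃ T : H →L[ℂ] H', ∀ a, T (e a) = f a := by
  have hdense : DenseRange (linearCombination ℂ e) := by
    rwa [DenseRange, ← LinearMap.coe_range, range_linearCombination]
  refine ⟨(linearCombination ℂ f).extendOfNorm (linearCombination ℂ e), fun a ↦ ?_⟩
  simpa using LinearMap.extendOfNorm_eq hdense ⟨C, hf⟩ (single a 1)

lemma exists_clm_of_inner_eq_inner_apply [CompleteSpace H']
    (he : Dense (span ℂ (range e) : Set H)) {f : α → H'} (T : H →L[ℂ] H)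
    (hT : ∀ a b, ⟪f a, f b⟫_ℂ = ⟪e a, T (e b)⟫_ℂ) :
    ∃ V : H →L[ℂ] H', ∀ a, V (e a) = f a := by
  refine exists_clm_of_norm_linearCombination_le he (C := √‖T‖) fun v ↦ ?_
  refine le_of_sq_le_sq ?_ (by positivity)
  have hinner : ⟪linearCombination ℂ f v, linearCombination ℂ f v⟫_ℂ =
      ⟪linearCombination ℂ e v, T (linearCombination ℂ e v)⟫_ℂ := by
    rw [← ContinuousLinearMap.coe_coe T, Finsupp.apply_linearCombination]
    exact inner_linearCombination_eq hT v v
  calc ‖linearCombination ℂ f v‖ ^ 2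
      = ‖⟪linearCombination ℂ f v, linearCombination ℂ f v⟫_ℂ‖ := by
        rw [inner_self_eq_norm_sq_to_K]; simp
    _ ≤ ‖linearCombination ℂ e v‖ * ‖T (linearCombination ℂ e v)‖ := by
        rw [hinner]; exact norm_inner_le_norm _ _
    _ ≤ ‖linearCombination ℂ e v‖ * (‖T‖ * ‖linearCombination ℂ e v‖) := by
        gcongr; exact T.le_opNorm _
    _ = (√‖T‖ * ‖linearCombination ℂ e v‖) ^ 2 := by
        rw [mul_pow, Real.sq_sqrt (norm_nonneg T)]; ring

variable {B : Type*} [CStarAlgebra B]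

lemma norm_le_norm_mul_of_inner_eq {p : B →ₗ[ℂ] H} {x : H}
    (h : ∀ b c, ⟪p b, p c⟫_ℂ = ⟪x, p (star b * c)⟫_ℂ) (b : B) : ‖p b‖ ≤ ‖b‖ * ‖x‖ := by
  let _ : PartialOrder B := CStarAlgebra.spectralOrder B
  let _ : StarOrderedRing B := CStarAlgebra.spectralOrderedRing B
  have hsq (c : B) : (‖p c‖ ^ 2 : ℂ) = ⟪x, p (star c * c)⟫_ℂ := by
    rw [← h, inner_self_eq_norm_sq_to_K (𝕜 := ℂ)]
    rfl
  have hone : ‖p 1‖ ≤ ‖x‖ := by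
    have hle : ‖p 1‖ * ‖p 1‖ ≤ ‖x‖ * ‖p 1‖ := by
      calc ‖p 1‖ * ‖p 1‖ = ‖(‖p 1‖ ^ 2 : ℂ)‖ := by simp [sq]
        _ = ‖⟪x, p 1⟫_ℂ‖ := by rw [hsq, star_one, one_mul]
        _ ≤ ‖x‖ * ‖p 1‖ := norm_inner_le_norm _ _
    rcases (norm_nonneg (p 1)).eq_or_lt with h0 | h0
    · rw [← h0]; positivity
    · exact le_of_mul_le_mul_right hle h0
  obtain ⟨c, hc⟩ := CStarAlgebra.nonneg_iff_eq_star_mul_self.1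
    (sub_nonneg.2 (CStarAlgebra.star_mul_le_algebraMap_norm_sq (a := b)))
  have hsum : star b * b + star c * c = ((‖b‖ ^ 2 : ℝ) : ℂ) • (star (1 : B) * 1) := by
    rw [← hc, add_sub_cancel, Algebra.algebraMap_eq_smul_one, star_one, one_mul,
      Complex.coe_smul]
  have key : ‖p b‖ ^ 2 + ‖p c‖ ^ 2 = ‖b‖ ^ 2 * ‖p 1‖ ^ 2 := by
    have : (‖p b‖ ^ 2 + ‖p c‖ ^ 2 : ℂ) = ‖b‖ ^ 2 * ‖p 1‖ ^ 2 := by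
      rw [hsq, hsq, hsq, ← inner_add_right, ← map_add, hsum, map_smul, inner_smul_right,
        Complex.ofReal_pow]
    exact_mod_cast this
  refine le_of_sq_le_sq ?_ (by positivity)
  calc ‖p b‖ ^ 2 ≤ ‖p b‖ ^ 2 + ‖p c‖ ^ 2 := le_add_of_nonneg_right (by positivity)
    _ = ‖b‖ ^ 2 * ‖p 1‖ ^ 2 := key
    _ ≤ ‖b‖ ^ 2 * ‖x‖ ^ 2 := by gcongr
    _ = (‖b‖ * ‖x‖) ^ 2 := (mul_pow _ _ _).symm

lemma exists_representation_of_action [CompleteSpace H] (he : Dense (span ℂ (range e) : Set H))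
    (act : B → α → α) (hadd : ∀ b c a, e (act (b + c) a) = e (act b a) + e (act c a))
    (hsmul : ∀ (z : ℂ) b a, e (act (z • b) a) = z • e (act b a))
    (hmul : ∀ b c a, e (act (b * c) a) = e (act b (act c a)))
    (hstar : ∀ b a a', ⟪e (act b a), e a'⟫_ℂ = ⟪e a, e (act (star b) a')⟫_ℂ) :
    ∃ π : B →⋆ₙₐ[ℂ] (H →L[ℂ] H), ∀ b a, π b (e a) = e (act b a) := by
  have hnorm (b : B) (v : α →₀ ℂ) :
      ‖linearCombination ℂ (fun a ↦ e (act b a)) v‖ ≤ ‖b‖ * ‖linearCombination ℂ e v‖ := by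
    let p : B →ₗ[ℂ] H :=
      { toFun b := linearCombination ℂ (fun a ↦ e (act b a)) v
        map_add' b c := by simp only [linearCombination_apply, hadd, smul_add, Finsupp.sum_add]
        map_smul' z b := by
          simp only [linearCombination_apply, hsmul, smul_comm _ z, Finsupp.smul_sum,
            RingHom.id_apply] }
    refine norm_le_norm_mul_of_inner_eq (p := p) (fun b c ↦ ?_) b
    exact inner_linearCombination_eq (fun a a' ↦ by rw [hstar, hmul]) v v
  choose π hπ using fun b ↦ exists_clm_of_norm_linearCombination_le he (hnorm b)
  have hsmul' (z : ℂ) (b : B) : π (z • b) = z • π b :=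
    clm_ext_of_dense he fun a ↦ by rw [hπ, hsmul, smul_apply, hπ]
  exact ⟨{
    toFun := π
    map_smul' := hsmul'
    map_zero' := by simpa using hsmul' 0 0
    map_add' b c := clm_ext_of_dense he fun a ↦ by rw [hπ, hadd, add_apply, hπ, hπ]
    map_mul' b c := clm_ext_of_dense he fun a ↦ by rw [hπ, hmul, mul_apply_eq_comp, hπ, hπ]
    map_star' b := clm_ext_of_dense he fun a ↦ eq_of_forall_inner_eq he fun a' ↦ by
      rw [ContinuousLinearMap.star_eq_adjoint, ContinuousLinearMap.adjoint_inner_right, hπ, hπ,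
        hstar] }, hπ⟩

end TotalFamily

section Gram

lemma exists_eq_star_mul_self_of_forall_conj {A : Type*} [NonUnitalCStarAlgebra A] {a : A}
    (ha : IsSelfAdjoint a) (h : ∀ b t : A, star b * a * b = -(star t * t) → t = 0) :
    ∃ s, a = star s * s := by
  let _ := CStarAlgebra.spectralOrder A
  let _ := CStarAlgebra.spectralOrderedRing A
  have hneg : IsSelfAdjoint a⁻ := (CFC.negPart_nonneg a).isSelfAdjoint
  have hconj : star a⁻ * a * a⁻ = -(a⁻ * a⁻ * a⁻) := by
    calc star a⁻ * a * a⁻ = a⁻ * (a⁺ - a⁻) * a⁻ := by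
          rw [CFC.posPart_sub_negPart a ha, hneg.star_eq]
      _ = -(a⁻ * a⁻ * a⁻) := by simp [mul_sub]
  obtain ⟨r, hr⟩ := CStarAlgebra.nonneg_iff_eq_star_mul_self.1 (CFC.negPart_nonneg a)
  have hr_zero : r * a⁻ = 0 := h a⁻ (r * a⁻) <| by
    rw [hconj, star_mul, hneg.star_eq, ← mul_assoc, mul_assoc _ (star r), ← hr]
  have hneg_zero : a⁻ = 0 := by
    rw [← CStarRing.star_mul_self_eq_zero_iff, hneg.star_eq]
    nth_rw 1 [hr]
    rw [mul_assoc, hr_zero, mul_zero]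
  refine CStarAlgebra.nonneg_iff_eq_star_mul_self.1 ?_
  rw [← CFC.posPart_sub_negPart a ha, hneg_zero, sub_zero]
  exact CFC.posPart_nonneg a

variable {ι : Type*} [Fintype ι] {A : Type*} [NonUnitalCStarAlgebra A] [PartialOrder A]
  [StarOrderedRing A]

lemma eq_zero_of_forall_diag_star_mul_self_nonpos {T : CStarMatrix ι ι A}
    (hT : ∀ i, (star T * T) i i ≤ 0) : T = 0 := by
  ext k i
  have hle : ∑ l, star (T l i) * T l i ≤ 0 := by
    simpa only [CStarMatrix.mul_apply, CStarMatrix.star_apply] using hT i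
  have hnonneg (l : ι) : 0 ≤ star (T l i) * T l i := star_mul_self_nonneg _
  have hzero := (Finset.sum_eq_zero_iff_of_nonneg fun l _ ↦ hnonneg l).1
    (hle.antisymm (Finset.sum_nonneg fun l _ ↦ hnonneg l)) k (Finset.mem_univ k)
  exact (CStarRing.star_mul_self_eq_zero_iff _).1 hzero

lemma exists_eq_sum_star_mul {M : ι → ι → A} (hM : ∀ i j, star (M i j) = M j i)
    (h : ∀ a : ι → A, 0 ≤ ∑ i, ∑ j, star (a i) * M i j * a j) :
    ∃ s : ι → ι → A, ∀ i j, M i j = ∑ k, star (s k i) * s k j := by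
  have hM' : IsSelfAdjoint (CStarMatrix.ofMatrix (Matrix.of M)) := by
    ext i j
    exact hM j i
  obtain ⟨s, hs⟩ := exists_eq_star_mul_self_of_forall_conj hM' fun b t hbt ↦ by
    -- The diagonal entries of `b* M b` are the values of the form `M` at the columns of `b`.
    refine eq_zero_of_forall_diag_star_mul_self_nonpos fun i ↦ ?_
    rw [← neg_eq_iff_eq_neg.2 hbt]
    refine neg_nonpos.2 ((h fun j ↦ b j i).trans_eq ?_)
    simp only [CStarMatrix.mul_apply, CStarMatrix.star_apply, Finset.sum_mul]
    exact Finset.sum_comm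
  refine ⟨fun k i ↦ s k i, fun i j ↦ ?_⟩
  simpa only [CStarMatrix.mul_apply] using! congrFun (congrFun hs i) j

variable {B : Type u} {X : Type v} [NonUnitalCStarAlgebra B] [PartialOrder B]
  [NormedAddCommGroup X] [NormedSpace ℂ X] [SMul Bᵐᵒᵖ X] [CStarModule Bᵐᵒᵖ X]

lemma rinner_zero_right (ξ : X) : rinner B ξ 0 = 0 := by simp [rinner]

lemma rinner_sum_right {κ : Type*} (t : Finset κ) (ξ : X) (η : κ → X) :
    rinner B ξ (∑ k ∈ t, η k) = ∑ k ∈ t, rinner B ξ (η k) :=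
  map_sum (AddMonoidHom.mk' (rinner B ξ) (rinner_add_right ξ)) η t

lemma rinner_self_nonneg (ξ : X) : 0 ≤ rinner B ξ ξ :=
  MulOpposite.unop_nonneg.2 CStarModule.inner_self_nonneg

lemma exists_rinner_eq_sum_star_mul [StarOrderedRing B] (ξ : ι → X) :
    ∃ s : ι → ι → B, ∀ i j, rinner B (ξ i) (ξ j) = ∑ k, star (s k i) * s k j := by
  refine exists_eq_sum_star_mul (fun i j ↦ star_rinner _ _) fun a ↦ ?_
  calc 0 ≤ rinner B (∑ i, ract (ξ i) (a i)) (∑ j, ract (ξ j) (a j)) := rinner_self_nonneg _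
    _ = ∑ i, rinner B (ract (ξ i) (a i)) (∑ j, ract (ξ j) (a j)) := by
      rw [← star_rinner, rinner_sum_right, star_sum]
      simp only [star_rinner]
    _ = ∑ i, ∑ j, star (a i) * rinner B (ξ i) (ξ j) * a j := by
      simp only [rinner_sum_right, rinner_ract, rinner_ract_left]

end Gram

section FockSpace

open Set Submodule
open scoped InnerProductSpace ComplexOrder

lemma posSemidef_of_forall_finset {α : Type*} {M : Matrix α α ℂ}
    (hM : ∀ s : Finset α, (M.submatrix ((↑) : s → α) (↑)).PosSemidef) : M.PosSemidef := by
  classical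
  refine ⟨?_, fun v ↦ ?_⟩
  · ext a b
    exact (hM {a, b}).1.apply ⟨a, by simp⟩ ⟨b, by simp⟩
  · have h := (hM v.support).dotProduct_mulVec_nonneg fun a ↦ v a
    simp only [dotProduct, Matrix.mulVec, Finset.mul_sum, ← mul_assoc] at h
    convert h using 1
    simp only [Finsupp.sum, ← Finset.sum_coe_sort v.support]
    rfl

namespace Correspondence

section Kernel

variable {B : Type u} {X : Type v} [NonUnitalCStarAlgebra B] [PartialOrder B]
  [StarOrderedRing B] [NormedAddCommGroup X] [NormedSpace ℂ X] [CompleteSpace X]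
  [SMul Bᵐᵒᵖ X] [CStarModule Bᵐᵒᵖ X] (E : Correspondence B X)
  {H : Type*} [NormedAddCommGroup H] [InnerProductSpace ℂ H] [CompleteSpace H]
  (ρ : B →⋆ₙₐ[ℂ] (H →L[ℂ] H))

/-- The left action of `B` on elementary tensors: the word `([ξ₁, …, ξₙ], h)` encodes the vector
`ξ₁ ⊗ ⋯ ⊗ ξₙ ⊗ h` of `X^{⊗ n} ⊗_ρ H`. -/
def wordAct (b : B) : List X × H → List X × H
  | ([], h) => ([], ρ b h)
  | (ξ :: l, h) => (E.leftAct b ξ :: l, h)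

/-- The inner product of two elementary tensors of the Fock space `⨁ₙ X^{⊗ n} ⊗_ρ H`, encoded as
words: `⟨ξ ⊗ x, η ⊗ y⟩ = ⟨x, ⟨ξ|η⟩ y⟩`, and tensors of different lengths are orthogonal. -/
def fockKernel : List X × H → List X × H → ℂ
  | ([], h), ([], k) => ⟪h, k⟫_ℂ
  | (ξ :: l, h), (η :: m, k) => fockKernel (l, h) (E.wordAct ρ (rinner B ξ η) (m, k))
  | ([], _), (_ :: _, _) => 0
  | (_ :: _, _), ([], _) => 0
termination_by x => x.1.length

variable {E ρ}

@[simp]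
lemma wordAct_nil (b : B) (h : H) : E.wordAct ρ b ([], h) = ([], ρ b h) := rfl

@[simp]
lemma wordAct_cons (b : B) (ξ : X) (l : List X) (h : H) :
    E.wordAct ρ b (ξ :: l, h) = (E.leftAct b ξ :: l, h) := rfl

@[simp]
lemma length_wordAct (b : B) (x : List X × H) : (E.wordAct ρ b x).1.length = x.1.length := by
  rcases x with ⟨_ | _, _⟩ <;> rfl

lemma wordAct_mul (b c : B) (x : List X × H) :
    E.wordAct ρ (b * c) x = E.wordAct ρ b (E.wordAct ρ c x) := by
  rcases x with ⟨_ | _, _⟩ <;> simp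

lemma fockKernel_wordAct_left (b : B) (x y : List X × H) :
    E.fockKernel ρ (E.wordAct ρ b x) y = E.fockKernel ρ x (E.wordAct ρ (star b) y) := by
  rcases x with ⟨_ | ⟨ξ, l⟩, h⟩ <;> rcases y with ⟨_ | ⟨η, m⟩, k⟩ <;>
    simp [fockKernel, E.rinner_leftAct, map_star, ContinuousLinearMap.star_eq_adjoint,
      ContinuousLinearMap.adjoint_inner_right]

lemma fockKernel_wordAct_add (b c : B) (x y : List X × H) :
    E.fockKernel ρ x (E.wordAct ρ (b + c) y) =
      E.fockKernel ρ x (E.wordAct ρ b y) + E.fockKernel ρ x (E.wordAct ρ c y) := by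
  obtain ⟨l, h⟩ := x
  induction l generalizing b c y with
  | nil => rcases y with ⟨_ | _, _⟩ <;> simp [fockKernel]
  | cons ξ l ih => rcases y with ⟨_ | _, _⟩ <;> simp [fockKernel, rinner_add_right, ih]

lemma fockKernel_wordAct_smul (z : ℂ) (b : B) (x y : List X × H) :
    E.fockKernel ρ x (E.wordAct ρ (z • b) y) = z * E.fockKernel ρ x (E.wordAct ρ b y) := by
  obtain ⟨l, h⟩ := x
  induction l generalizing b y with
  | nil => rcases y with ⟨_ | _, _⟩ <;> simp [fockKernel]
  | cons ξ l ih => rcases y with ⟨_ | _, _⟩ <;> simp [fockKernel, rinner_smul_right, ih]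

lemma fockKernel_wordAct_sum {ι : Type*} (s : Finset ι) (b : ι → B) (x y : List X × H) :
    E.fockKernel ρ x (E.wordAct ρ (∑ i ∈ s, b i) y) =
      ∑ i ∈ s, E.fockKernel ρ x (E.wordAct ρ (b i) y) :=
  map_sum (AddMonoidHom.mk' (fun b ↦ E.fockKernel ρ x (E.wordAct ρ b y))
    fun b c ↦ fockKernel_wordAct_add b c x y) b s

lemma fockKernel_wordAct_zero (x y : List X × H) :
    E.fockKernel ρ x (E.wordAct ρ 0 y) = 0 := by
  simpa using fockKernel_wordAct_sum (E := E) (ρ := ρ) ∅ (fun _ : B ↦ 0) x y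

lemma fockKernel_cons_add (ξ η : X) (l : List X) (h : H) (x : List X × H) :
    E.fockKernel ρ x ((ξ + η) :: l, h) =
      E.fockKernel ρ x (ξ :: l, h) + E.fockKernel ρ x (η :: l, h) := by
  rcases x with ⟨_ | _, _⟩ <;> simp [fockKernel, rinner_add_right, fockKernel_wordAct_add]

lemma fockKernel_cons_smul (z : ℂ) (ξ : X) (l : List X) (h : H) (x : List X × H) :
    E.fockKernel ρ x ((z • ξ) :: l, h) = z * E.fockKernel ρ x (ξ :: l, h) := by
  rcases x with ⟨_ | _, _⟩ <;> simp [fockKernel, rinner_smul_right, fockKernel_wordAct_smul]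

open Classical in
lemma fockKernel_eq_inner_add (x y : List X × H) :
    E.fockKernel ρ x y = ⟪if x.1 = [] then x.2 else 0, if y.1 = [] then y.2 else 0⟫_ℂ +
      E.fockKernel ρ (x.1.headD 0 :: x.1.tail, x.2) (y.1.headD 0 :: y.1.tail, y.2) := by
  have hzero_left (η : X) : rinner B (0 : X) η = 0 := by
    rw [← star_rinner, rinner_zero_right, star_zero]
  rcases x with ⟨_ | _, _⟩ <;> rcases y with ⟨_ | _, _⟩ <;>
    simp [fockKernel, rinner_zero_right, hzero_left, fockKernel_wordAct_zero, -wordAct_nil,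
      -wordAct_cons]

lemma posSemidef_fockKernel_of_length_le {ι : Type*} [Finite ι] {n : ℕ} {x : ι → List X × H}
    (hx : ∀ i, (x i).1.length ≤ n) :
    (Matrix.of fun i j ↦ E.fockKernel ρ (x i) (x j)).PosSemidef := by
  cases nonempty_fintype ι
  induction n generalizing x with
  | zero =>
    have hx_nil (i : ι) : (x i).1 = [] := List.length_eq_zero_iff.1 (Nat.le_zero.1 (hx i))
    have heq : (Matrix.of fun i j ↦ E.fockKernel ρ (x i) (x j)) =
        Matrix.gram ℂ fun i ↦ (x i).2 := by
      ext i j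
      rw [Matrix.of_apply, Matrix.gram_apply, ← Prod.mk.eta (p := x i), ← Prod.mk.eta (p := x j),
        hx_nil, hx_nil, fockKernel]
    rw [heq]
    exact Matrix.posSemidef_gram ℂ _
  | succ n ih =>
    classical
    obtain ⟨s, hs⟩ := exists_rinner_eq_sum_star_mul (B := B) fun i ↦ (x i).1.headD 0
    let y (k i : ι) : List X × H := E.wordAct ρ (s k i) ((x i).1.tail, (x i).2)
    have hy (k i : ι) : (y k i).1.length ≤ n := by
      rw [length_wordAct, List.length_tail]
      exact Nat.sub_le_of_le_add (hx i)
    have heq : (Matrix.of fun i j ↦ E.fockKernel ρ (x i) (x j)) =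
        Matrix.gram ℂ (fun i ↦ if (x i).1 = [] then (x i).2 else 0) +
          ∑ k, Matrix.of fun i j ↦ E.fockKernel ρ (y k i) (y k j) := by
      ext i j
      rw [Matrix.of_apply, fockKernel_eq_inner_add, Matrix.add_apply, Matrix.gram_apply,
        fockKernel, hs, fockKernel_wordAct_sum, Matrix.sum_apply]
      refine congrArg _ (Finset.sum_congr rfl fun k _ ↦ ?_)
      rw [Matrix.of_apply, fockKernel_wordAct_left, wordAct_mul]
    rw [heq]
    exact (Matrix.posSemidef_gram ℂ _).add (Matrix.posSemidef_sum _ fun k _ ↦ ih (hy k))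

variable (E ρ) in
lemma posSemidef_fockKernel : (Matrix.of (E.fockKernel ρ)).PosSemidef :=
  posSemidef_of_forall_finset fun s ↦
    posSemidef_fockKernel_of_length_le (x := ((↑) : s → List X × H)) fun x ↦
      s.le_sup (f := fun x ↦ x.1.length) x.2

end Kernel

variable {B : Type u} {X : Type v} [CStarAlgebra B] [PartialOrder B]
  [StarOrderedRing B] [NormedAddCommGroup X] [NormedSpace ℂ X] [CompleteSpace X]
  [SMul Bᵐᵒᵖ X] [CStarModule Bᵐᵒᵖ X] (E : Correspondence B X)
  {H : Type w} [NormedAddCommGroup H] [InnerProductSpace ℂ H] [CompleteSpace H]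
  (ρ : B →⋆ₙₐ[ℂ] (H →L[ℂ] H))

lemma exists_fockSpace : ∃ (F : Type (max v w)) (_ : NormedAddCommGroup F)
    (_ : InnerProductSpace ℂ F) (_ : CompleteSpace F) (e : List X × H → F)
    (π : B →⋆ₙₐ[ℂ] (F →L[ℂ] F)) (T : X → F →L[ℂ] F), Dense (span ℂ (range e) : Set F) ∧
      (∀ x y, ⟪e x, e y⟫_ℂ = E.fockKernel ρ x y) ∧ (∀ b x, π b (e x) = e (E.wordAct ρ b x)) ∧
      ∀ ξ x, T ξ (e x) = e (ξ :: x.1, x.2) := by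
  obtain ⟨F, _, _, _, e, he, hinner⟩ :=
    exists_hilbertSpace_of_posSemidef (E.posSemidef_fockKernel ρ)
  simp only [Matrix.of_apply] at hinner
  obtain ⟨π, hπ⟩ := exists_representation_of_action he (E.wordAct ρ)
    (fun b c y ↦ eq_of_forall_inner_eq he fun x ↦ by
      simp only [inner_add_right, hinner, fockKernel_wordAct_add])
    (fun z b y ↦ eq_of_forall_inner_eq he fun x ↦ by
      simp only [inner_smul_right, hinner, fockKernel_wordAct_smul])
    (fun b c x ↦ by rw [wordAct_mul])
    (fun b x y ↦ by rw [hinner, hinner, fockKernel_wordAct_left])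
  have hcreation (ξ : X) : ∃ T : F →L[ℂ] F, ∀ x, T (e x) = e (ξ :: x.1, x.2) :=
    exists_clm_of_inner_eq_inner_apply he (π (rinner B ξ ξ)) fun x y ↦ by
      rw [hπ, hinner, hinner, fockKernel]
  choose T hT using hcreation
  exact ⟨F, _, _, _, e, π, T, he, hinner, hπ, hT⟩

theorem exists_fockRepresentation : ∃ (F : Type (max v w)) (_ : NormedAddCommGroup F)
    (_ : InnerProductSpace ℂ F) (_ : CompleteSpace F) (e : List X × H → F)
    (R : ToeplitzRep E (F →L[ℂ] F)), Dense (span ℂ (range e) : Set F) ∧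
      (∀ h k, ⟪e ([], h), e ([], k)⟫_ℂ = ⟪h, k⟫_ℂ) ∧ (∀ b h, R.π b (e ([], h)) = e ([], ρ b h)) ∧
      (∀ ξ l h, R.t ξ (e (l, h)) = e (ξ :: l, h)) ∧ ∀ ξ h, star (R.t ξ) (e ([], h)) = 0 := by
  obtain ⟨F, _, _, _, e, π, T, he, hinner, hπ, hT⟩ := E.exists_fockSpace ρ
  have hadjoint (ξ : X) (x y) : ⟪e x, star (T ξ) (e y)⟫_ℂ = E.fockKernel ρ (ξ :: x.1, x.2) y := by
    rw [ContinuousLinearMap.star_eq_adjoint, ContinuousLinearMap.adjoint_inner_right, hT, hinner]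
  let t : X →ₗ[ℂ] F →L[ℂ] F :=
    { toFun := T
      map_add' ξ η := clm_ext_of_dense he fun y ↦ eq_of_forall_inner_eq he fun x ↦ by
        simp only [add_apply, hT, inner_add_right, hinner, fockKernel_cons_add]
      map_smul' z ξ := clm_ext_of_dense he fun y ↦ eq_of_forall_inner_eq he fun x ↦ by
        simp only [RingHom.id_apply, smul_apply, hT, inner_smul_right, hinner,
          fockKernel_cons_smul] }
  let R : ToeplitzRep E (F →L[ℂ] F) :=
    { π := π
      t := t
      π_mul_t b ξ := clm_ext_of_dense he fun x ↦ by
        change π b (T ξ (e x)) = T (E.leftAct b ξ) (e x)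
        rw [hT, hT, hπ, wordAct_cons]
      star_t_mul_t ξ η := clm_ext_of_dense he fun y ↦ eq_of_forall_inner_eq he fun x ↦ by
        change ⟪e x, star (T ξ) (T η (e y))⟫_ℂ = ⟪e x, π (rinner B ξ η) (e y)⟫_ℂ
        rw [hT, hadjoint, hπ, hinner, fockKernel] }
  refine ⟨F, _, _, _, e, R, he, fun h k ↦ by rw [hinner, fockKernel], fun b h ↦ hπ b ([], h),
    fun ξ l h ↦ hT ξ (l, h), fun ξ k ↦ eq_of_forall_inner_eq he fun x ↦ ?_⟩
  exact (hadjoint ξ x ([], k)).trans (by rw [fockKernel, inner_zero_right])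

end Correspondence
end FockSpace

section Coisometric

variable {B : Type u} {X : Type v} [NonUnitalCStarAlgebra B] [PartialOrder B]
  [StarOrderedRing B] [NormedAddCommGroup X] [NormedSpace ℂ X] [CompleteSpace X]
  [SMul Bᵐᵒᵖ X] [CStarModule Bᵐᵒᵖ X] {E : Correspondence B X}

namespace ToeplitzRep

lemma ext {D : Type w} [NonUnitalCStarAlgebra D] {R R' : ToeplitzRep E D} (hπ : R.π = R'.π)
    (ht : R.t = R'.t) : R = R' := by
  cases R
  cases R'
  congr

lemma compactMap_mul_t {D : Type w} [NonUnitalCStarAlgebra D] (R : ToeplitzRep E D)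
    (T : compactOps B X) (μ : X) : R.compactMap T * R.t μ = R.t ((T : X →L[ℂ] X) μ) := by
  have ht : Continuous R.t :=
    AddMonoidHomClass.continuous_of_bound R.t 1 fun ξ ↦ by simpa using R.norm_t_le ξ
  have hleft : Continuous fun T : compactOps B X ↦ R.compactMap T * R.t μ := by fun_prop
  have hright : Continuous fun T : compactOps B X ↦ R.t ((T : X →L[ℂ] X) μ) := by fun_prop
  refine congrFun (denseRange_finiteRank.equalizer hleft hright (funext fun f ↦ ?_)) T
  exact (congrArg (· * R.t μ) (R.compactMap_finiteRank f)).trans (R.finiteRankMap_mul_t f μ)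

lemma compactMap_apply_eq_zero {H : Type*} [NormedAddCommGroup H] [InnerProductSpace ℂ H]
    [CompleteSpace H] (R : ToeplitzRep E (H →L[ℂ] H)) {x : H} (hx : ∀ ξ, star (R.t ξ) x = 0)
    (T : compactOps B X) : R.compactMap T x = 0 := by
  have hcont : Continuous fun T : compactOps B X ↦ R.compactMap T x := by fun_prop
  refine congrFun (denseRange_finiteRank.equalizer hcont continuous_const (funext fun f ↦ ?_)) T
  have hrank (ξ η : X) : (R.t ξ * star (R.t η)) x = 0 :=
    (congrArg (R.t ξ) (hx η)).trans (map_zero _)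
  simp [compactMap_finiteRank, finiteRankMap, Finsupp.linearCombination_apply, Finsupp.sum,
    hrank]

lemma IsCoisometricOn.of_map {D : Type*} {D' : Type*} [NonUnitalCStarAlgebra D]
    [NonUnitalCStarAlgebra D'] {R : ToeplitzRep E D} {S : Set B} {ρ : D →⋆ₙₐ[ℂ] D'}
    (h : (R.map ρ).IsCoisometricOn S) (hρ : Function.Injective ρ) : R.IsCoisometricOn S :=
  fun b hb ↦ (h b hb).imp fun _ hRb ↦ hρ (hRb.trans (R.compactMap_map ρ _))

end ToeplitzRep

namespace RelCuntzPimsner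

variable {S : Set B}

lemma map_lift {D : Type w} [NonUnitalCStarAlgebra D] {R : ToeplitzRep E D}
    (hR : R.IsCoisometricOn S) : (univRep E S).map (lift R hR) = R :=
  ToeplitzRep.ext (NonUnitalStarAlgHom.ext (lift_π R hR)) (LinearMap.ext (lift_t R hR))

theorem toCuntzPimsner_surjective (hS : S ⊆ E.katsuraIdeal) :
    Function.Surjective (toCuntzPimsner hS) := by
  have hrange := ToeplitzRep.generated_le (R := univRep E E.katsuraIdeal)
    (M := NonUnitalStarAlgHom.range (toCuntzPimsner hS))
    (isClosed_range_of_nonUnitalStarAlgHom (toCuntzPimsner hS))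
    (fun b ↦ ⟨(univRep E S).π b, lift_π _ _ b⟩) (fun ξ ↦ ⟨(univRep E S).t ξ, lift_t _ _ ξ⟩)
  rw [generated_univRep] at hrange
  exact fun y ↦ hrange (NonUnitalStarAlgebra.mem_top (x := y))

theorem isCoisometricOn_katsuraIdeal_of_injective {hS : S ⊆ E.katsuraIdeal}
    (hinj : Function.Injective (toCuntzPimsner hS)) {D : Type w} [NonUnitalCStarAlgebra D]
    {R : ToeplitzRep E D} (hR : R.IsCoisometricOn S) : R.IsCoisometricOn E.katsuraIdeal := by
  have huniv : (univRep E E.katsuraIdeal).IsCoisometricOn E.katsuraIdeal :=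
    isCoisometricOn_univRep fun _ h ↦ h.1
  have hmap : (univRep E S).map (toCuntzPimsner hS) = univRep E E.katsuraIdeal :=
    map_lift fun b hb ↦ huniv b (hS hb)
  have hS_univ : (univRep E S).IsCoisometricOn E.katsuraIdeal := .of_map (hmap ▸ huniv) hinj
  exact map_lift hR ▸ hS_univ.map (lift R hR)

end RelCuntzPimsner

lemma Correspondence.katsuraIdeal_eq_univ (hfaithful : Function.Injective E.leftAct)
    (hcompact : ∀ b : B, E.leftAct b ∈ compactOps B X) : E.katsuraIdeal = Set.univ :=
  Set.eq_univ_of_forall fun y ↦ ⟨hcompact y, fun x hx ↦ by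
    rw [(map_eq_zero_iff E.leftAct hfaithful).1 hx, zero_mul]⟩

end Coisometric

theorem Correspondence.exists_toeplitzRep_π_eq_compactMap_iff {B : Type u} {X : Type v}
    [CStarAlgebra B] [PartialOrder B] [StarOrderedRing B] [NormedAddCommGroup X]
    [NormedSpace ℂ X] [CompleteSpace X] [SMul Bᵐᵒᵖ X] [CStarModule Bᵐᵒᵖ X]
    (E : Correspondence B X) {H : Type w} [NormedAddCommGroup H] [InnerProductSpace ℂ H]
    [CompleteSpace H] (ρ : B →⋆ₙₐ[ℂ] (H →L[ℂ] H)) :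
    ∃ (F : Type (max v w)) (_ : NormedAddCommGroup F) (_ : InnerProductSpace ℂ F)
      (_ : CompleteSpace F) (R : ToeplitzRep E (F →L[ℂ] F)),
      ∀ b (hb : E.leftAct b ∈ compactOps B X),
        R.π b = R.compactMap ⟨E.leftAct b, hb⟩ ↔ ρ b = 0 := by
  obtain ⟨F, _, _, _, e, R, he, hinner, hπ, ht, hstar⟩ := E.exists_fockRepresentation ρ
  have hvacuum (T : compactOps B X) (h : H) : R.compactMap T (e ([], h)) = 0 :=
    R.compactMap_apply_eq_zero (hstar · h) T
  have he_nil_eq_zero (h : H) : e ([], h) = 0 ↔ h = 0 := by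
    rw [← inner_self_eq_zero (𝕜 := ℂ), hinner, inner_self_eq_zero]
  refine ⟨F, _, _, _, R, fun b hb ↦ ⟨fun heq ↦ ?_, fun hρ ↦ clm_ext_of_dense he ?_⟩⟩
  · ext h
    exact (he_nil_eq_zero _).1 (by rw [← hπ, heq, hvacuum])
  · rintro ⟨_ | ⟨ξ, l⟩, h⟩
    · rw [hvacuum, hπ, he_nil_eq_zero, hρ, _root_.zero_apply]
    · rw [← ht, ← mul_apply_eq_comp, ← mul_apply_eq_comp, R.compactMap_mul_t, R.π_mul_t]

end CStarCorr
end

theorem mainTheorem5_general {B : Type*} {X : Type*} [CStarAlgebra B] [PartialOrder B]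
    [StarOrderedRing B] [NormedAddCommGroup X] [NormedSpace ℂ X] [CompleteSpace X]
    [SMul Bᵐᵒᵖ X] [CStarModule Bᵐᵒᵖ X] (E : CStarCorr.Correspondence B X)
    (I : TwoSidedIdeal B) (hclosed : IsClosed (I : Set B)) (hI : (I : Set B) ⊂ E.katsuraIdeal) :
    Function.Surjective (CStarCorr.RelCuntzPimsner.toCuntzPimsner hI.subset) ∧
      ¬ Function.Injective (CStarCorr.RelCuntzPimsner.toCuntzPimsner hI.subset) := by
  refine ⟨CStarCorr.RelCuntzPimsner.toCuntzPimsner_surjective _, fun hinj ↦ ?_⟩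
  obtain ⟨x, hxJ, hxI⟩ := Set.exists_of_ssubset hI
  obtain ⟨H, _, _, _, ρ, hρI, hρx⟩ :=
    CStarCorr.exists_representation_apply_ne_zero hclosed hxI
  obtain ⟨F, _, _, _, R, hR⟩ := E.exists_toeplitzRep_π_eq_compactMap_iff ρ
  have hRI : R.IsCoisometricOn (I : Set B) := fun b hb ↦
    ⟨(hI.subset hb).1, (hR b _).2 (hρI b hb)⟩
  obtain ⟨hx, hRx⟩ :=
    CStarCorr.RelCuntzPimsner.isCoisometricOn_katsuraIdeal_of_injective hinj hRI x hxJ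
  exact hρx ((hR x hx).1 hRx)

theorem mainTheorem5 {B : Type*} {X : Type*} [CStarAlgebra B] [PartialOrder B]
    [StarOrderedRing B] [FiniteDimensional ℂ B] [NormedAddCommGroup X] [NormedSpace ℂ X]
    [CompleteSpace X] [SMul Bᵐᵒᵖ X] [CStarModule Bᵐᵒᵖ X]
    (E : CStarCorr.Correspondence B X)
    (hfaithful : Function.Injective E.leftAct)
    (hcompact : ∀ b : B, E.leftAct b ∈ CStarCorr.compactOps B X)
    (I : TwoSidedIdeal B) (hclosed : IsClosed (I : Set B)) (hstar : ∀ a ∈ I, star a ∈ I)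
    (hproper : I ≠ ⊤) (hI : (I : Set B) ⊆ E.katsuraIdeal) :
    Function.Surjective (CStarCorr.RelCuntzPimsner.toCuntzPimsner hI) ∧
      ¬ Function.Injective (CStarCorr.RelCuntzPimsner.toCuntzPimsner hI) :=
  mainTheorem5_general E I hclosed <| hI.ssubset_of_ne fun h ↦ hproper <| SetLike.coe_injective <|
    (h.trans (E.katsuraIdeal_eq_univ hfaithful hcompact)).trans (TwoSidedIdeal.coe_top B).symm
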